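/- All spaces consist of (real or complex) measurable functions on $(0,\infty)$ with Lebesgue measure $m$, modulo equality almost everywhere. For $0<p\le\infty$, $L_p$ is the usual Lebesgue space with its (quasi-)norm; $L_0$ is the space of functions whose support has finite measure, with $\|f\|_{0}=m(\operatorname{supp} f)$. A quasi-Banach function space is a linear space $E$ of measurable functions with a complete quasi-norm $\|\cdot\|_E$ such that $f\in E$, $g$ measurable and $|g|\le|f|$ a.e. imply $g\in E$ and $\|g\|_E\le\|f\|_E$. A linear operator $T:L_p+L_q\to L_p+L_q$ is bounded on the couple $(L_p,L_q)$ if there is a constant $C$ such that for $r\in\{p,q\}$ and all $f\in L_r$ we have $Tf\in L_r$ and $\|Tf\|_{r}\le C\|f\|_{r}$. We write $E\in\mathrm{Int}(L_p,L_q)$ if $L_p\cap L_q\subset E\subset L_p+L_q$ and every operator $T$ bounded on $(L_p,L_q)$ maps $E$ to $E$ and is bounded there, i.e. $\|Tf\|_E\le C_T\|f\|_E$ for all $f\in E$ and some constant $C_T$ depending on $T$. Let $\mu(t,f)=\inf\{\lambda\ge0: m(\{|f|>\lambda\})\le t\}$, $t>0$, be the decreasing rearrangement of $f$. Write $g\prec\prec_{\mathrm{hd}}f$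 if $\int_0^t\mu(s,g)\,ds\le\int_0^t\mu(s,f)\,ds$ for all $t>0$, and $g\prec\prec_{\mathrm{tl}}f$ if $\int_t^\infty\mu(s,g)\,ds\le\int_t^\infty\mu(s,f)\,ds$ for all $t>0$. **Theorem.** Let $0\le p<q\le\infty$ and let $E$ be a quasi-Banach function space with $E\in\mathrm{Int}(L_p,L_q)$. Then there exist constants $c_{p,E},c_{q,E}>0$ such that: (i) if $p\ne0$: for all $f\in E$ and $g\in L_p+L_\infty$ with $|g|^p\prec\prec_{\mathrm{hd}}|f|^p$, we have $g\in E$ and $\|g\|_E\le c_{p,E}\|f\|_E$; (ii) if $q\ne\infty$: for all $f\in E$ and $g\in L_0+L_q$ with $|g|^q\prec\prec_{\mathrm{tl}}|f|^q$, we have $g\in E$ and $\|g\|_E\le c_{q,E}\|f\|_E$. -/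

import Mathlib

open MeasureTheory Set Filter Topology
open scoped ENNReal

noncomputable section

/-- Lebesgue measure on the half line `(0, ∞)`. -/
abbrev halfLine : Measure ℝ := volume.restrict (Ioi (0 : ℝ))

/-- The linear space `𝒳` of all measurable scalar functions on `(0, ∞)`, modulo equality
almost everywhere. -/
abbrev MeasFun (𝕜 : Type*) [RCLike 𝕜] := ℝ →ₘ[halfLine] 𝕜

/-- A linear space of measurable functions on `(0, ∞)` with a real-valued functional measuring the
size of its elements (a quasi-norm, or `f ↦ m (supp f)` in the case of `L_0`). The values of `size`
outside of `carrier` are irrelevant. -/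
structure SizedSpace (𝕜 : Type*) [RCLike 𝕜] where
  carrier : Submodule 𝕜 (MeasFun 𝕜)
  size : MeasFun 𝕜 → ℝ

/-- A quasi-Banach function space: a linear space of measurable functions with a complete quasi-norm
`size` which is solid. -/
structure QuasiBanachFunctionSpace (𝕜 : Type*) [RCLike 𝕜] extends SizedSpace 𝕜 where
  size_nonneg : ∀ f ∈ carrier, 0 ≤ size f
  size_eq_zero_iff : ∀ f ∈ carrier, size f = 0 ↔ f = 0
  size_smul : ∀ (a : 𝕜), ∀ f ∈ carrier, size (a • f) = ‖a‖ * size f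
  size_add_le : ∃ C : ℝ, ∀ f ∈ carrier, ∀ g ∈ carrier, size (f + g) ≤ C * (size f + size g)
  complete : ∀ u : ℕ → MeasFun 𝕜, (∀ n, u n ∈ carrier) →
    (∀ ε : ℝ, 0 < ε → ∃ N : ℕ, ∀ m ≥ N, ∀ n ≥ N, size (u m - u n) < ε) →
    ∃ f ∈ carrier, Tendsto (fun n => size (u n - f)) atTop (𝓝 0)
  solid : ∀ f ∈ carrier, ∀ g : MeasFun 𝕜, (∀ᵐ x ∂halfLine, ‖g x‖ ≤ ‖f x‖) →
    g ∈ carrier ∧ size g ≤ size f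

/-- `L_0`: the functions whose support has finite measure, with `‖f‖_0 = m (supp f)`. -/
def Lzero (𝕜 : Type*) [RCLike 𝕜] : SizedSpace 𝕜 where
  carrier :=
    { carrier := {f | halfLine {x | f x ≠ 0} < ∞}
      zero_mem' := by
        have h : halfLine {x | (0 : MeasFun 𝕜) x ≠ 0} = 0 := by
          have := AEEqFun.coeFn_zero (μ := halfLine) (α := ℝ) (β := 𝕜)
          exact ae_iff.1 this
        simp only [mem_ofPred_eq, h, ENNReal.zero_lt_top]
      add_mem' := by
        intro f g hf hg
        refine lt_of_le_of_lt (measure_mono_ae ?_)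
          (lt_of_le_of_lt (measure_union_le {x | f x ≠ 0} {x | g x ≠ 0})
            (ENNReal.add_lt_top.2 ⟨hf, hg⟩))
        filter_upwards [AEEqFun.coeFn_add f g] with x hx hne
        by_contra hcon
        have h1 : f x = 0 := by
          by_contra h
          exact hcon (Or.inl h)
        have h2 : g x = 0 := by
          by_contra h
          exact hcon (Or.inr h)
        apply hne
        rw [hx, Pi.add_apply, h1, h2, add_zero]
      smul_mem' := by
        intro a f hf
        refine lt_of_le_of_lt (measure_mono_ae ?_) hf
        filter_upwards [AEEqFun.coeFn_smul a f] with x hx hne h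
        apply hne
        rw [hx, Pi.smul_apply, h, smul_zero] }
  size f := (halfLine {x | f x ≠ 0}).toReal

/-- The space `L_p` on `(0, ∞)`, for `p ∈ [0, ∞]`. -/
def LSpace (𝕜 : Type*) [RCLike 𝕜] (p : ℝ≥0∞) : SizedSpace 𝕜 :=
  if p = 0 then Lzero 𝕜
  else
    { carrier := Lp.LpSubmodule 𝕜 𝕜 p halfLine
      size := fun f => (eLpNorm f p halfLine).toReal }

/-- The linear operator `T`, defined on a space `V` of functions, restricts to a bounded operator
`A → A`, where `A ⊆ V`. -/
def RestrictsBounded {𝕜 : Type*} [RCLike 𝕜] {V : Submodule 𝕜 (MeasFun 𝕜)} (T : V →ₗ[𝕜] V)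
    (A : SizedSpace 𝕜) : Prop :=
  ∃ C : ℝ, ∀ f : V, (f : MeasFun 𝕜) ∈ A.carrier →
    (T f : MeasFun 𝕜) ∈ A.carrier ∧ A.size (T f) ≤ C * A.size f

/-- `T : A + B → A + B` is bounded on the couple `(A, B)`. -/
def BoundedOnCouple {𝕜 : Type*} [RCLike 𝕜] (A B : SizedSpace 𝕜)
    (T : ↥(A.carrier ⊔ B.carrier) →ₗ[𝕜] ↥(A.carrier ⊔ B.carrier)) : Prop :=
  RestrictsBounded T A ∧ RestrictsBounded T B

/-- `E` is an interpolation space for the couple `(A, B)`. -/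
def IsInterpolationSpace {𝕜 : Type*} [RCLike 𝕜] (A B E : SizedSpace 𝕜) : Prop :=
  A.carrier ⊓ B.carrier ≤ E.carrier ∧ E.carrier ≤ A.carrier ⊔ B.carrier ∧
    ∀ T : ↥(A.carrier ⊔ B.carrier) →ₗ[𝕜] ↥(A.carrier ⊔ B.carrier),
      BoundedOnCouple A B T → RestrictsBounded T E

/-- The right-continuous decreasing rearrangement
`μ(t, F) = inf {l ≥ 0 : m {F > l} ≤ t}` of a nonnegative function `F` on `(0, ∞)`. -/
def rearrangement (F : ℝ → ℝ≥0∞) (t : ℝ) : ℝ≥0∞ :=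
  sInf {l : ℝ≥0∞ | halfLine {x | l < F x} ≤ ENNReal.ofReal t}

/-- Head majorization `G ≺≺_hd F`. -/
def HeadMajorized (G F : ℝ → ℝ≥0∞) : Prop :=
  ∀ t : ℝ, 0 < t →
    ∫⁻ s in Ioo 0 t, rearrangement G s ≤ ∫⁻ s in Ioo 0 t, rearrangement F s

/-- Tail majorization `G ≺≺_tl F`. -/
def TailMajorized (G F : ℝ → ℝ≥0∞) : Prop :=
  ∀ t : ℝ, 0 < t →
    ∫⁻ s in Ioi t, rearrangement G s ≤ ∫⁻ s in Ioi t, rearrangement F s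

/-- The function `|f|^r`. -/
def absPow {𝕜 : Type*} [RCLike 𝕜] (f : MeasFun 𝕜) (r : ℝ) : ℝ → ℝ≥0∞ :=
  fun x => ‖f x‖ₑ ^ r

end

/-!
Weighted composition operators `f ↦ w · (f ∘ φ)` whose `L_p` and `L_q` bounds are at most `C` act on
an interpolation space `E` with norms bounded by a constant depending only on `E` and `C`.
Otherwise a gliding hump, run on countably many disjoint copies of the half line, assembles a
sequence of bad operators into a single one which is bounded on the couple but not on `E`.

Let `|g|^p` be head majorized by `|f|^p`. At the dyadic levels above which `|f|^p` is integrable,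
the mass of `|g|^p` above a level is at most twice the mass of `|f|^p` above half that level, so a
monotone rearrangement of the line gives a map `φ` which transports the density `|g|^p` into
`2 |f|^p` and satisfies `|g| ≤ M |f ∘ φ|`. The operator with weight `g / (f ∘ φ)` is then bounded on
`L_p` and on `L_∞`, hence on `L_q`, and it sends `f` to the restriction of `g` to these levels. At
the remaining levels `|f|` is bounded below on a set of infinite measure, onto which one can
transport Lebesgue measure; the resulting operator is bounded on `L_0` and on `L_∞`.

For tail majorization of `|g|^q` by `|f|^q`, at every dyadic level either the masses of the two
functions below the level are comparable or their distribution functions are. The first kind of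
levels gives an operator bounded on `L_q` whose weight is nowhere in `(0, 1)`, hence bounded on
`L_p`, and the second kind one bounded on `L_0` and on `L_∞`.
-/

section MonotoneTransport

variable {μ ν : Measure ℝ}

theorem isLocallyFiniteMeasure_of_measure_Iic_ne_top (hμ : ∀ x, μ (Iic x) ≠ ∞) :
    IsLocallyFiniteMeasure μ :=
  ⟨fun x => ⟨Iic (x + 1), Iic_mem_nhds (by linarith), (hμ _).lt_top⟩⟩

theorem continuousWithinAt_measure_Iic (hμ : ∀ x, μ (Iic x) ≠ ∞) (x : ℝ) :
    ContinuousWithinAt (fun y => μ (Iic y)) (Ici x) x := by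
  rw [← continuousWithinAt_Ioi_iff_Ici]
  have hinter : ⋂ r > x, Iic r = Iic x := by
    ext y
    simpa only [mem_iInter, mem_Iic] using forall_gt_imp_ge_iff_le_of_dense
  have := tendsto_measure_biInter_gt (μ := μ) (a := x) (s := Iic)
    (fun _ _ => measurableSet_Iic.nullMeasurableSet) (fun _ _ _ h => Iic_subset_Iic.2 h)
    ⟨x + 1, by simp, hμ _⟩
  rwa [hinter] at this

theorem tendsto_measure_Iic_atBot (hμ : ∀ x, μ (Iic x) ≠ ∞) :
    Tendsto (fun x => μ (Iic x)) atBot (𝓝 0) := by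
  have hinter : ⋂ x : ℝ, Iic x = ∅ := by
    rw [iInter_Iic_eq_empty_iff]
    simp only [range_id', not_bddBelow_univ, not_false_eq_true]
  have := tendsto_measure_iInter_atBot (μ := μ) (s := fun x : ℝ => Iic x)
    (fun _ => measurableSet_Iic.nullMeasurableSet) (fun _ _ h => Iic_subset_Iic.2 h) ⟨0, hμ 0⟩
  rwa [hinter, measure_empty] at this

theorem measure_Ioc_eq_sub (hμ : ∀ x, μ (Iic x) ≠ ∞) {a b : ℝ} (hab : a ≤ b) :
    μ (Ioc a b) = μ (Iic b) - μ (Iic a) := by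
  rw [← Iic_sdiff_Iic, measure_sdiff (Iic_subset_Iic.2 hab) measurableSet_Iic.nullMeasurableSet
    (hμ a)]

theorem exists_stieltjesFunction_measure_eq (hμ : ∀ x, μ (Iic x) ≠ ∞) :
    ∃ f : StieltjesFunction ℝ, f.measure = μ := by
  have hmono : Monotone fun x => (μ (Iic x)).toReal := fun _ b h =>
    ENNReal.toReal_mono (hμ b) (measure_mono (Iic_subset_Iic.2 h))
  let f : StieltjesFunction ℝ :=
    { toFun := fun x => (μ (Iic x)).toReal
      mono' := hmono
      right_continuous' := fun x =>
        (ENNReal.tendsto_toReal (hμ x)).comp (continuousWithinAt_measure_Iic hμ x) }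
  refine ⟨f, Measure.ext_of_Ioc _ _ fun a b hab => ?_⟩
  rw [f.measure_Ioc, measure_Ioc_eq_sub hμ hab.le]
  change ENNReal.ofReal ((μ (Iic b)).toReal - (μ (Iic a)).toReal) = _
  rw [ENNReal.ofReal_sub _ ENNReal.toReal_nonneg, ENNReal.ofReal_toReal (hμ b),
    ENNReal.ofReal_toReal (hμ a)]

theorem measure_le_of_Ioc_le (hν : ∀ x, ν (Iic x) ≠ ∞) (h : ∀ a b, μ (Ioc a b) ≤ ν (Ioc a b)) :
    μ ≤ ν := by
  obtain ⟨f, rfl⟩ := exists_stieltjesFunction_measure_eq hν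
  have houter : μ.toOuterMeasure ≤ f.outer := by
    refine OuterMeasure.le_ofFunction.2 fun s => ?_
    rw [StieltjesFunction.length_eq]
    refine le_iInf₂ fun a b => le_iInf fun hab => ?_
    rw [← f.measure_Ioc]
    refine (measure_mono fun x hx => ?_).trans (h a b)
    exact hab ⟨hx, fun hb => not_isBot x hb⟩
  refine Measure.le_iff.2 fun s _ => ?_
  rw [StieltjesFunction.measure]
  exact houter s

/-- For an atomless measure the distribution function is continuous, so its values are uniformly
distributed. -/
theorem measure_setOf_measure_Iic_mem_Icc_le [NullSingletonClass μ] (hμ : ∀ x, μ (Iic x) ≠ ∞)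
    (a b : ℝ≥0∞) : μ {x | μ (Iic x) ∈ Icc a b} ≤ b - a := by
  have := isLocallyFiniteMeasure_of_measure_Iic_ne_top hμ
  have hmono : Monotone fun x => μ (Iic x) := fun _ _ h => measure_mono (Iic_subset_Iic.2 h)
  have hmeas : MeasurableSet {x | μ (Iic x) ∈ Icc a b} := hmono.measurable measurableSet_Icc
  rw [hmeas.measure_eq_iSup_isCompact]
  refine iSup_le fun K => iSup_le fun hK => iSup_le fun hc => ?_
  rcases K.eq_empty_or_nonempty with rfl | hne
  · simp only [measure_empty, zero_le]
  obtain ⟨x, hx⟩ := hc.exists_isLeast hne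
  obtain ⟨y, hy⟩ := hc.exists_isGreatest hne
  calc μ K ≤ μ (Icc x y) := measure_mono fun z hz => ⟨hx.2 hz, hy.2 hz⟩
    _ = μ (Ioc x y) := Ioc_ae_eq_Icc.measure_eq.symm
    _ = μ (Iic y) - μ (Iic x) := measure_Ioc_eq_sub hμ (hx.2 hy.1)
    _ ≤ b - a := tsub_le_tsub (hK hy.1).2 (hK hx.1).1

theorem ae_measure_Iic_ne [NullSingletonClass μ] (hμ : ∀ x, μ (Iic x) ≠ ∞) (c : ℝ≥0∞) :
    ∀ᵐ x ∂μ, μ (Iic x) ≠ c := by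
  have h := measure_setOf_measure_Iic_mem_Icc_le hμ c c
  simpa only [Icc_self, mem_singleton_iff, tsub_self, nonpos_iff_eq_zero, ae_iff, not_not] using h

theorem sInf_setOf_le_measure_Iic_le_iff (hν : ∀ x, ν (Iic x) ≠ ∞) {s : ℝ≥0∞} (hs : s ≠ 0)
    (hs' : s < ν univ) (y : ℝ) : sInf {z | s ≤ ν (Iic z)} ≤ y ↔ s ≤ ν (Iic y) := by
  have hne : {z | s ≤ ν (Iic z)}.Nonempty :=
    ((tendsto_measure_Iic_atTop ν).eventually_const_le hs').exists
  obtain ⟨w, hw⟩ := ((tendsto_measure_Iic_atBot hν).eventually_lt_const hs.bot_lt).exists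
  have hbdd : BddBelow {z | s ≤ ν (Iic z)} := by
    refine ⟨w, fun z hz => le_of_not_gt fun hzw => hw.not_ge ?_⟩
    exact le_trans hz (measure_mono (Iic_subset_Iic.2 hzw.le))
  refine ⟨fun h => ?_, fun h => csInf_le hbdd h⟩
  refine le_trans ?_ (measure_mono (Iic_subset_Iic.2 h))
  have hcont := (continuousWithinAt_measure_Iic hν (sInf {z | s ≤ ν (Iic z)})).mono
    Ioi_subset_Ici_self
  refine ge_of_tendsto hcont.tendsto ?_
  filter_upwards [self_mem_nhdsWithin] with z hz
  obtain ⟨u, hu, huz⟩ := exists_lt_of_csInf_lt hne hz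
  exact le_trans hu (measure_mono (Iic_subset_Iic.2 huz.le))

theorem exists_map_le [NullSingletonClass μ] (hμ : ∀ x, μ (Iic x) ≠ ∞) (hν : ∀ x, ν (Iic x) ≠ ∞)
    (h : μ univ ≤ ν univ) : ∃ φ : ℝ → ℝ, Measurable φ ∧ μ.map φ ≤ ν ∧
      ∀ᵐ x ∂μ, ∀ y, φ x ≤ y ↔ μ (Iic x) ≤ ν (Iic y) := by
  have hmono : Monotone fun x => μ (Iic x) := fun _ _ h => measure_mono (Iic_subset_Iic.2 h)
  let D := {x | μ (Iic x) ≠ 0 ∧ μ (Iic x) < ν univ}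
  let φ := fun x => sInf {y | μ (Iic x) ≤ ν (Iic y)}
  have hD : MeasurableSet D :=
    (hmono.measurable (measurableSet_singleton 0).compl).inter (hmono.measurable measurableSet_Iio)
  have hφ_le : ∀ x ∈ D, ∀ y, φ x ≤ y ↔ μ (Iic x) ≤ ν (Iic y) := fun x hx =>
    sInf_setOf_le_measure_Iic_le_iff hν hx.1 hx.2
  have hφ_mono : MonotoneOn φ D := fun x hx y hy hxy =>
    (hφ_le x hx _).2 ((hmono hxy).trans ((hφ_le y hy _).1 le_rfl))
  have hae : ∀ᵐ x ∂μ, x ∈ D := by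
    filter_upwards [ae_measure_Iic_ne hμ 0, ae_measure_Iic_ne hμ (ν univ)] with x hzero htop
    exact ⟨hzero, lt_of_le_of_ne ((measure_mono (subset_univ _)).trans h) htop⟩
  have hφ : AEMeasurable φ μ := by
    rw [← Measure.restrict_eq_self_of_ae_mem hae]
    exact aemeasurable_restrict_of_monotoneOn hD hφ_mono
  refine ⟨hφ.mk φ, hφ.measurable_mk, ?_, ?_⟩
  · rw [← Measure.map_congr hφ.ae_eq_mk]
    refine measure_le_of_Ioc_le hν fun a b => ?_
    rcases le_or_gt b a with hab | hab
    · simp only [Ioc_eq_empty hab.not_gt, measure_empty, le_refl]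
    rw [Measure.map_apply_of_aemeasurable hφ measurableSet_Ioc, measure_Ioc_eq_sub hν hab.le]
    refine (measure_mono_ae ?_).trans (measure_setOf_measure_Iic_mem_Icc_le hμ _ _)
    filter_upwards [hae] with x hx hxab
    exact ⟨le_of_not_ge fun hle => hxab.1.not_ge ((hφ_le x hx a).2 hle), (hφ_le x hx b).1 hxab.2⟩
  · filter_upwards [hae, hφ.ae_eq_mk] with x hx hmk
    rw [← hmk]
    exact hφ_le x hx

end MonotoneTransport

section LevelTransport

variable {α β : Type*} [MeasurableSpace α] [StandardBorelSpace α] [MeasurableSpace β]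
  [StandardBorelSpace β] {κ : α → ℤ} {l : β → ℤ}

/-- An embedding into the line that sorts points by decreasing level: the points of level `k` are
sent into `(-k, -k + 1)`. -/
noncomputable def levelEmbed (κ : α → ℤ) (x : α) : ℝ := -κ x + Real.sigmoid (embeddingReal α x)

theorem levelEmbed_mem_Ioo (κ : α → ℤ) (x : α) :
    levelEmbed κ x ∈ Ioo (-κ x : ℝ) (-κ x + 1) :=
  ⟨lt_add_of_pos_right _ (Real.sigmoid_pos _), add_lt_add_right (Real.sigmoid_lt_one _) _⟩

theorem floor_levelEmbed (κ : α → ℤ) (x : α) : ⌊levelEmbed κ x⌋ = -κ x := by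
  have h := levelEmbed_mem_Ioo κ x
  rw [Int.floor_eq_iff]
  push_cast
  exact ⟨h.1.le, h.2⟩

theorem measurableEmbedding_levelEmbed (hκ : Measurable κ) :
    MeasurableEmbedding (levelEmbed κ) := by
  have hinj : Function.Injective (levelEmbed κ) := fun x y hxy => by
    have hlevel : κ x = κ y := by
      have := floor_levelEmbed κ x
      rwa [hxy, floor_levelEmbed, neg_inj, eq_comm] at this
    rw [levelEmbed, levelEmbed, hlevel, add_right_inj, Real.sigmoid_inj] at hxy
    exact (measurableEmbedding_embeddingReal α).injective hxy
  have hcast : Measurable fun x => (κ x : ℝ) := measurable_from_top.comp hκ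
  exact (hcast.neg.add (continuous_sigmoid.measurable.comp
    (measurable_embeddingReal α))).measurableEmbedding hinj

theorem map_levelEmbed_Iic_le (hκ : Measurable κ) (μ : Measure α) (y : ℝ) :
    μ.map (levelEmbed κ) (Iic y) ≤ μ {x | -⌊y⌋ ≤ κ x} := by
  rw [(measurableEmbedding_levelEmbed hκ).map_apply]
  refine measure_mono fun x hx => ?_
  have := Int.floor_le_floor (show levelEmbed κ x ≤ y from hx)
  rw [floor_levelEmbed] at this
  exact neg_le.1 this

theorem measure_setOf_le_le_map_levelEmbed_Iic (hκ : Measurable κ) (μ : Measure α) (k : ℤ) :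
    μ {x | k ≤ κ x} ≤ μ.map (levelEmbed κ) (Iic (-k + 1)) := by
  rw [(measurableEmbedding_levelEmbed hκ).map_apply]
  refine measure_mono fun x hx => (levelEmbed_mem_Ioo κ x).2.le.trans ?_
  gcongr
  exact hx

theorem exists_map_le_and_le_level [Nonempty β] {μ : Measure α} [NullSingletonClass μ]
    {ν : Measure β} (hκ : Measurable κ) (hl : Measurable l)
    (hle : ∀ k, μ {x | k ≤ κ x} ≤ ν {x | k ≤ l x}) (hfin : ∀ k, ν {x | k ≤ l x} ≠ ∞) :
    ∃ φ : α → β, Measurable φ ∧ μ.map φ ≤ ν ∧ ∀ᵐ x ∂μ, κ x ≤ l (φ x) := by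
  have heκ := measurableEmbedding_levelEmbed hκ
  have hel := measurableEmbedding_levelEmbed hl
  have hIic : ∀ k : ℤ, μ {x | k ≤ κ x} ≤ ν.map (levelEmbed l) (Iic (-k + 1)) := fun k =>
    (hle k).trans (measure_setOf_le_le_map_levelEmbed_Iic hl ν k)
  have hμI : ∀ y, μ.map (levelEmbed κ) (Iic y) ≠ ∞ := fun y =>
    ne_top_of_le_ne_top (hfin _) ((map_levelEmbed_Iic_le hκ μ y).trans (hle _))
  have hνI : ∀ y, ν.map (levelEmbed l) (Iic y) ≠ ∞ := fun y =>
    ne_top_of_le_ne_top (hfin _) (map_levelEmbed_Iic_le hl ν y)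
  have : NullSingletonClass (μ.map (levelEmbed κ)) := ⟨fun y => by
    rw [heκ.map_apply]
    exact (subsingleton_singleton.preimage heκ.injective).measure_zero μ⟩
  have huniv : μ.map (levelEmbed κ) univ ≤ ν.map (levelEmbed l) univ :=
    le_of_tendsto' (tendsto_measure_Iic_atTop _) fun y =>
      (map_levelEmbed_Iic_le hκ μ y).trans ((hIic _).trans (measure_mono (subset_univ _)))
  obtain ⟨ψ, hψ, hmap, hψ_le⟩ := exists_map_le hμI hνI huniv
  refine ⟨hel.invFun ∘ ψ ∘ levelEmbed κ, hel.measurable_invFun.comp (hψ.comp heκ.measurable),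
    ?_, ?_⟩
  · rw [← Measure.map_map hel.measurable_invFun (hψ.comp heκ.measurable),
      ← Measure.map_map hψ heκ.measurable]
    refine (Measure.map_mono hmap hel.measurable_invFun).trans_eq ?_
    rw [Measure.map_map hel.measurable_invFun hel.measurable, hel.leftInverse_invFun.comp_eq_id,
      Measure.map_id]
  · have hrange : ∀ᵐ y ∂(ν.map (levelEmbed l)), y ∈ range (levelEmbed l) :=
      ae_map_mem_range _ hel.measurableSet_range _
    filter_upwards [ae_of_ae_map heκ.measurable.aemeasurable
        (ae_of_ae_map hψ.aemeasurable (ae_mono hmap hrange)),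
      ae_of_ae_map heκ.measurable.aemeasurable hψ_le] with x ⟨z, hz⟩ hx
    have hψx : ψ (levelEmbed κ x) ≤ -κ x + 1 := by
      refine (hx _).2 ((map_levelEmbed_Iic_le hκ μ _).trans ?_)
      rw [floor_levelEmbed, neg_neg]
      exact hIic _
    rw [Function.comp_apply, Function.comp_apply, ← hz, hel.leftInverse_invFun z]
    have hlt : (-l z : ℝ) < -κ x + 1 := (levelEmbed_mem_Ioo l z).1.trans_le (hz.le.trans hψx)
    have : -l z < -κ x + 1 := by exact_mod_cast hlt
    omega

end LevelTransport

section Rearrangement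

variable {α : Type*} [MeasurableSpace α] {F G : ℝ → ℝ≥0∞}

theorem halfLine_setOf_ofReal_lt (y : ℝ≥0∞) : halfLine {l | ENNReal.ofReal l < y} = y := by
  rw [Measure.restrict_apply (measurableSet_lt ENNReal.measurable_ofReal measurable_const)]
  rcases eq_or_ne y ∞ with rfl | hy
  · simp only [ENNReal.ofReal_lt_top, ofPred_true, univ_inter, Real.volume_Ioi]
  have : {l : ℝ | ENNReal.ofReal l < y} ∩ Ioi 0 = Ioo 0 y.toReal := by
    ext l
    simp only [mem_inter_iff, mem_ofPred_eq, mem_Ioi, mem_Ioo]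
    rw [and_comm]
    exact and_congr_right fun h => ENNReal.ofReal_lt_iff_lt_toReal h.le hy
  rw [this, Real.volume_Ioo, sub_zero, ENNReal.ofReal_toReal hy]

theorem lintegral_eq_lintegral_measure_ofReal_lt (μ : Measure α) [SFinite μ] {F : α → ℝ≥0∞}
    (hF : Measurable F) : ∫⁻ x, F x ∂μ = ∫⁻ l, μ {x | ENNReal.ofReal l < F x} ∂halfLine := by
  let S : Set (α × ℝ) := {z | ENNReal.ofReal z.2 < F z.1}
  have hS : MeasurableSet S :=
    measurableSet_lt (ENNReal.measurable_ofReal.comp measurable_snd) (hF.comp measurable_fst)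
  calc ∫⁻ x, F x ∂μ
      = ∫⁻ x, halfLine (Prod.mk x ⁻¹' S) ∂μ :=
        lintegral_congr fun x => (halfLine_setOf_ofReal_lt (F x)).symm
    _ = (μ.prod halfLine) S := (Measure.prod_apply hS).symm
    _ = ∫⁻ l, μ ((fun x => (x, l)) ⁻¹' S) ∂halfLine := Measure.prod_apply_symm hS

theorem lintegral_eq_of_measure_setOf_lt_eq {β : Type*} [MeasurableSpace β] {μ : Measure α}
    {ν : Measure β} [SFinite μ] [SFinite ν] {F : α → ℝ≥0∞} {G : β → ℝ≥0∞} (hF : Measurable F)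
    (hG : Measurable G) (h : ∀ l ≠ ∞, μ {x | l < F x} = ν {y | l < G y}) :
    ∫⁻ x, F x ∂μ = ∫⁻ y, G y ∂ν := by
  rw [lintegral_eq_lintegral_measure_ofReal_lt μ hF, lintegral_eq_lintegral_measure_ofReal_lt ν hG]
  exact lintegral_congr fun l => h _ ENNReal.ofReal_ne_top

theorem lintegral_Ioi_le_of_forall_lt {f : ℝ → ℝ≥0∞} {a : ℝ} {C : ℝ≥0∞}
    (h : ∀ b > a, ∫⁻ x in Ioi b, f x ≤ C) : ∫⁻ x in Ioi a, f x ≤ C := by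
  have hanti : Antitone fun n : ℕ => a + 1 / ((n : ℝ) + 1) := fun m n hmn =>
    add_le_add_right (Nat.one_div_le_one_div hmn) _
  have hunion : ⋃ n : ℕ, Ioi (a + 1 / ((n : ℝ) + 1)) = Ioi a := by
    ext x
    simp only [mem_iUnion, mem_Ioi]
    refine ⟨fun ⟨n, hn⟩ => (lt_add_of_pos_right a Nat.one_div_pos_of_nat).trans hn, fun hx => ?_⟩
    obtain ⟨n, hn⟩ := exists_nat_one_div_lt (sub_pos.2 hx)
    exact ⟨n, by linarith⟩
  rw [← hunion, setLIntegral_iUnion_of_directed _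
    (directed_of_isDirected_le fun m n hmn => Ioi_subset_Ioi (hanti hmn))]
  exact iSup_le fun n => h _ (lt_add_of_pos_right a Nat.one_div_pos_of_nat)

theorem lintegral_Ioi_le_of_forall_gt {f : ℝ → ℝ≥0∞} {a : ℝ} {C : ℝ≥0∞}
    (h : ∀ b > a, ∫⁻ x in Ioo a b, f x ≤ C) : ∫⁻ x in Ioi a, f x ≤ C := by
  have hunion : ⋃ n : ℕ, Ioo a (a + ((n : ℝ) + 1)) = Ioi a := by
    ext x
    simp only [mem_iUnion, mem_Ioo, mem_Ioi, exists_and_left, and_iff_left_iff_imp]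
    intro _
    obtain ⟨n, hn⟩ := exists_nat_gt (x - a)
    exact ⟨n, by linarith⟩
  rw [← hunion, setLIntegral_iUnion_of_directed _
    (directed_of_isDirected_le fun m n hmn => Ioo_subset_Ioo_right (by gcongr))]
  exact iSup_le fun n => h _ (lt_add_of_pos_right a (by positivity))

theorem rearrangement_antitone (F : ℝ → ℝ≥0∞) : Antitone (rearrangement F) := fun _ _ hst =>
  sInf_le_sInf fun _ hl => le_trans hl (ENNReal.ofReal_le_ofReal hst)

theorem lt_rearrangement_iff (F : ℝ → ℝ≥0∞) (l : ℝ≥0∞) (s : ℝ) :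
    l < rearrangement F s ↔ ENNReal.ofReal s < halfLine {x | l < F x} := by
  rw [← not_iff_not, not_lt, not_lt]
  refine ⟨fun h => ?_, fun h => sInf_le h⟩
  rcases eq_or_ne l ∞ with rfl | hl
  · simp only [not_top_lt, ofPred_false, measure_empty, zero_le]
  obtain ⟨u, hanti, hul, hlim⟩ := exists_seq_strictAnti_tendsto' hl.lt_top
  have hset : {x | l < F x} = ⋃ n, {x | u n < F x} := by
    ext x
    simp only [mem_ofPred_eq, mem_iUnion]
    exact ⟨fun hx => (hlim.eventually_lt_const hx).exists, fun ⟨n, hn⟩ => (hul n).1.trans hn⟩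
  have hmono : Monotone fun n => {x | u n < F x} := fun a b hab x hx =>
    lt_of_le_of_lt (hanti.antitone hab) hx
  rw [hset, hmono.measure_iUnion]
  refine iSup_le fun n => ?_
  obtain ⟨l', hl', hlt⟩ := sInf_lt_iff.1 (lt_of_le_of_lt h (hul n).1)
  exact (measure_mono fun x hx => hlt.trans hx).trans hl'

theorem halfLine_setOf_lt_rearrangement (F : ℝ → ℝ≥0∞) (l : ℝ≥0∞) :
    halfLine {s | l < rearrangement F s} = halfLine {x | l < F x} := by
  simp only [lt_rearrangement_iff, halfLine_setOf_ofReal_lt]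

theorem lintegral_rearrangement_tsub (hF : Measurable F) (a : ℝ≥0∞) :
    ∫⁻ s, (rearrangement F s - a) ∂halfLine = ∫⁻ x, (F x - a) ∂halfLine := by
  refine lintegral_eq_of_measure_setOf_lt_eq ((rearrangement_antitone F).measurable.sub_const a)
    (hF.sub_const a) fun l _ => ?_
  simp only [lt_tsub_iff_right, halfLine_setOf_lt_rearrangement]

theorem lintegral_min_rearrangement (hF : Measurable F) (a : ℝ≥0∞) :
    ∫⁻ s, min (rearrangement F s) a ∂halfLine = ∫⁻ x, min (F x) a ∂halfLine := by
  refine lintegral_eq_of_measure_setOf_lt_eq ((rearrangement_antitone F).measurable.min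
    measurable_const) (hF.min measurable_const) fun l _ => ?_
  by_cases hl : l < a
  · simp only [lt_min_iff, hl, and_true, halfLine_setOf_lt_rearrangement]
  · simp only [lt_min_iff, hl, and_false, ofPred_false, measure_empty]

theorem HeadMajorized.lintegral_Ioo_tsub_le (h : HeadMajorized G F) {a : ℝ≥0∞} (ha : a ≠ ∞) {s : ℝ}
    (hs : 0 < s) (hsG : ENNReal.ofReal s ≤ halfLine {x | a < G x}) :
    ∫⁻ r in Ioo 0 s, (rearrangement G r - a) ≤ ∫⁻ r, (rearrangement F r - a) ∂halfLine := by
  have hconst : ∫⁻ _ in Ioo 0 s, a ≠ ∞ := by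
    rw [setLIntegral_const, Real.volume_Ioo]
    finiteness
  refine (ENNReal.add_le_add_iff_right hconst).1 ?_
  calc (∫⁻ r in Ioo 0 s, (rearrangement G r - a)) + ∫⁻ _ in Ioo 0 s, a
      = ∫⁻ r in Ioo 0 s, rearrangement G r := by
        rw [← lintegral_add_right _ measurable_const]
        refine setLIntegral_congr_fun measurableSet_Ioo fun r hr => tsub_add_cancel_of_le ?_
        refine ((lt_rearrangement_iff G a r).2 (lt_of_lt_of_le ?_ hsG)).le
        exact (ENNReal.ofReal_lt_ofReal_iff hs).2 hr.2
    _ ≤ ∫⁻ r in Ioo 0 s, rearrangement F r := h s hs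
    _ ≤ ∫⁻ r in Ioo 0 s, (rearrangement F r - a + a) := lintegral_mono fun r => le_tsub_add
    _ ≤ (∫⁻ r, (rearrangement F r - a) ∂halfLine) + ∫⁻ _ in Ioo 0 s, a := by
        rw [lintegral_add_right _ measurable_const]
        exact add_le_add (lintegral_mono_set Ioo_subset_Ioi_self) le_rfl

theorem HeadMajorized.lintegral_tsub_le (h : HeadMajorized G F) (hG : Measurable G)
    (hF : Measurable F) {a : ℝ≥0∞} (ha : a ≠ ∞) :
    ∫⁻ x, (G x - a) ∂halfLine ≤ ∫⁻ x, (F x - a) ∂halfLine := by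
  rw [← lintegral_rearrangement_tsub hG, ← lintegral_rearrangement_tsub hF]
  refine lintegral_Ioi_le_of_forall_gt fun s hs => ?_
  rcases le_or_gt (ENNReal.ofReal s) (halfLine {x | a < G x}) with hst | hst
  · exact h.lintegral_Ioo_tsub_le ha hs hst
  set t := (halfLine {x | a < G x}).toReal with ht
  have ht_eq : ENNReal.ofReal t = halfLine {x | a < G x} := ENNReal.ofReal_toReal hst.ne_top
  have hle : ∫⁻ r in Ioo 0 s, (rearrangement G r - a)
      ≤ ∫⁻ r in Ioo 0 t, (rearrangement G r - a) := by
    rw [← lintegral_indicator measurableSet_Ioo, ← lintegral_indicator measurableSet_Ioo]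
    refine lintegral_mono (indicator_le (s := Ioo 0 s) fun r hr => ?_)
    by_cases hrt : r < t
    · rw [indicator_of_mem (show r ∈ Ioo 0 t from ⟨hr.1, hrt⟩)]
    refine (tsub_eq_zero_of_le (not_lt.1 fun hlt => ?_)).trans_le zero_le
    rw [lt_rearrangement_iff, ← ht_eq] at hlt
    exact hrt ((ENNReal.ofReal_lt_ofReal_iff_of_nonneg hr.1.le).1 hlt)
  refine hle.trans ?_
  rcases ENNReal.toReal_nonneg.eq_or_lt with h0 | h0
  · rw [← ht] at h0
    simp only [← h0, Ioo_self, Measure.restrict_empty, lintegral_zero_measure, zero_le]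
  · exact h.lintegral_Ioo_tsub_le ha h0 ht_eq.le

theorem HeadMajorized.lintegral_ge_le (h : HeadMajorized G F) (hG : Measurable G)
    (hF : Measurable F) {a : ℝ≥0∞} (ha : a ≠ ∞) :
    ∫⁻ x in {x | 2 * a ≤ G x}, G x ∂halfLine ≤ 2 * ∫⁻ x in {x | a ≤ F x}, F x ∂halfLine := by
  have hset : MeasurableSet {x | 2 * a ≤ G x} := measurableSet_le measurable_const hG
  have hGa : ∀ x ∈ {x | 2 * a ≤ G x}, G x ≤ 2 * (G x - a) := fun x hx => by
    rw [ENNReal.mul_sub fun _ _ => ENNReal.ofNat_ne_top]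
    refine ENNReal.le_sub_of_add_le_right (by finiteness) ?_
    rw [two_mul (G x)]
    exact add_le_add_right hx _
  calc ∫⁻ x in {x | 2 * a ≤ G x}, G x ∂halfLine
      ≤ ∫⁻ x in {x | 2 * a ≤ G x}, 2 * (G x - a) ∂halfLine := setLIntegral_mono' hset hGa
    _ ≤ ∫⁻ x, 2 * (G x - a) ∂halfLine := setLIntegral_le_lintegral _ _
    _ = 2 * ∫⁻ x, (G x - a) ∂halfLine := lintegral_const_mul _ (hG.sub_const a)
    _ ≤ 2 * ∫⁻ x, (F x - a) ∂halfLine := by gcongr 2 * ?_; exact h.lintegral_tsub_le hG hF ha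
    _ ≤ 2 * ∫⁻ x in {x | a ≤ F x}, F x ∂halfLine := by
        gcongr 2 * ?_
        rw [← lintegral_indicator (measurableSet_le measurable_const hF)]
        refine lintegral_mono fun x => ?_
        by_cases hx : a ≤ F x
        · exact tsub_le_self.trans_eq (indicator_of_mem (s := {x | a ≤ F x}) hx F).symm
        · simp only [tsub_eq_zero_of_le (not_le.1 hx).le, zero_le]

theorem lintegral_min_eq (hF : Measurable F) (a : ℝ≥0∞) :
    ∫⁻ x, min (F x) a ∂halfLine
      = (∫⁻ x in {x | F x < a}, F x ∂halfLine) + a * halfLine {x | a ≤ F x} := by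
  have hset : MeasurableSet {x | F x < a} := measurableSet_lt hF measurable_const
  have hcompl : {x | F x < a}ᶜ = {x | a ≤ F x} := by
    ext x
    simp only [mem_compl_iff, mem_ofPred_eq, not_lt]
  rw [← lintegral_add_compl _ hset, hcompl]
  congr 1
  · exact setLIntegral_congr_fun hset fun x hx => min_eq_left (le_of_lt hx)
  · rw [← setLIntegral_const]
    exact setLIntegral_congr_fun (hcompl ▸ hset.compl) fun x hx => min_eq_right hx

theorem TailMajorized.lintegral_min_le (h : TailMajorized G F) (hG : Measurable G)
    (hF : Measurable F) (a : ℝ≥0∞) :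
    ∫⁻ x, min (G x) a ∂halfLine ≤ ∫⁻ x, min (F x) a ∂halfLine := by
  rcases eq_or_ne a 0 with rfl | ha
  · simp only [zero_le, min_eq_right, lintegral_zero, le_refl]
  rcases eq_or_ne (halfLine {x | a < F x}) ∞ with htop | htop
  · have hsub : {x | a < F x} ⊆ {x | a ≤ F x} := fun x (hx : a < F x) => hx.le
    have : halfLine {x | a ≤ F x} = ∞ := measure_mono_top hsub htop
    simp only [lintegral_min_eq hF, this, ENNReal.mul_top ha, add_top, le_top]
  rw [← lintegral_min_rearrangement hG, ← lintegral_min_rearrangement hF]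
  set t := (halfLine {x | a < F x}).toReal with ht
  have ht_iff : ∀ s, a < rearrangement F s ↔ ENNReal.ofReal s < ENNReal.ofReal t := fun s => by
    rw [lt_rearrangement_iff, ht, ENNReal.ofReal_toReal htop]
  have h0 : 0 ≤ t := ENNReal.toReal_nonneg
  have hsplit : ∀ u : ℝ → ℝ≥0∞, ∫⁻ s, u s ∂halfLine
      = (∫⁻ s in Ioo 0 t, u s) + ∫⁻ s in Ioi t, u s := fun u => by
    rw [restrict_Ioo_eq_restrict_Ioc, ← lintegral_union measurableSet_Ioi
      (Ioc_disjoint_Ioi le_rfl), Ioc_union_Ioi_eq_Ioi h0]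
  rw [hsplit, hsplit]
  refine add_le_add (setLIntegral_mono' measurableSet_Ioo fun s hs => ?_) ?_
  · refine (min_le_right _ _).trans (le_min (le_of_lt ?_) le_rfl)
    exact (ht_iff s).2 ((ENNReal.ofReal_lt_ofReal_iff_of_nonneg hs.1.le).2 hs.2)
  calc ∫⁻ s in Ioi t, min (rearrangement G s) a
      ≤ ∫⁻ s in Ioi t, rearrangement G s := lintegral_mono fun s => min_le_left _ _
    _ ≤ ∫⁻ s in Ioi t, rearrangement F s :=
        lintegral_Ioi_le_of_forall_lt fun b hb => (h b (h0.trans_lt hb)).trans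
          (lintegral_mono_set (Ioi_subset_Ioi hb.le))
    _ ≤ ∫⁻ s in Ioi t, min (rearrangement F s) a :=
        setLIntegral_mono' measurableSet_Ioi fun s hs => le_min le_rfl <| not_lt.1 fun hlt =>
          ((ht_iff s).1 hlt).not_ge (ENNReal.ofReal_le_ofReal (le_of_lt hs))

theorem TailMajorized.lintegral_lt_le_or (h : TailMajorized G F) (hG : Measurable G)
    (hF : Measurable F) {a : ℝ≥0∞} (ha : a ≠ 0) (ha' : a ≠ ∞) :
    (∫⁻ x in {x | G x < 2 * a}, G x ∂halfLine ≤ 4 * ∫⁻ x in {x | F x < a}, F x ∂halfLine) ∨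
      halfLine {x | a ≤ G x} ≤ 2 * halfLine {x | a ≤ F x} := by
  have hmin := h.lintegral_min_le hG hF a
  rw [lintegral_min_eq hF] at hmin
  rcases le_total (a * halfLine {x | a ≤ F x}) (∫⁻ x in {x | F x < a}, F x ∂halfLine) with
    hle | hle
  · left
    calc ∫⁻ x in {x | G x < 2 * a}, G x ∂halfLine
        ≤ ∫⁻ x in {x | G x < 2 * a}, 2 * min (G x) a ∂halfLine :=
          setLIntegral_mono' (measurableSet_lt hG measurable_const) fun x hx => by
            rw [mul_min]
            exact le_min (le_mul_of_one_le_left' one_le_two) (le_of_lt hx)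
      _ ≤ ∫⁻ x, 2 * min (G x) a ∂halfLine := setLIntegral_le_lintegral _ _
      _ = 2 * ∫⁻ x, min (G x) a ∂halfLine :=
          lintegral_const_mul _ (hG.min measurable_const)
      _ ≤ 2 * ((∫⁻ x in {x | F x < a}, F x ∂halfLine)
            + ∫⁻ x in {x | F x < a}, F x ∂halfLine) :=
          mul_le_mul_right (hmin.trans (add_le_add_right hle _)) 2
      _ = 4 * ∫⁻ x in {x | F x < a}, F x ∂halfLine := by ring
  · right
    refine (ENNReal.mul_le_mul_iff_right ha ha').1 ?_
    calc a * halfLine {x | a ≤ G x}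
        ≤ ∫⁻ x, min (G x) a ∂halfLine := by
          rw [lintegral_min_eq hG]
          exact le_add_self
      _ ≤ a * halfLine {x | a ≤ F x} + a * halfLine {x | a ≤ F x} :=
          hmin.trans (add_le_add_left hle _)
      _ = a * (2 * halfLine {x | a ≤ F x}) := by ring

end Rearrangement

/-- The data of a weighted composition operator `f ↦ weight · (f ∘ map)`. -/
structure WeightedComp (𝕜 : Type*) [RCLike 𝕜] where
  weight : ℝ → 𝕜
  map : ℝ → ℝ
  measurable_weight : Measurable weight
  measurable_map : Measurable map

namespace WeightedComp

variable {𝕜 : Type*} [RCLike 𝕜] (S : WeightedComp 𝕜)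

/-- The weighted composition operator on classes of functions. -/
noncomputable def apply (f : MeasFun 𝕜) : MeasFun 𝕜 :=
  AEEqFun.mk (fun x => S.weight x * f (S.map x))
    (S.measurable_weight.stronglyMeasurable.mul
      (f.stronglyMeasurable.comp_measurable S.measurable_map)).aestronglyMeasurable

theorem coeFn_apply (f : MeasFun 𝕜) :
    S.apply f =ᵐ[halfLine] fun x => S.weight x * f (S.map x) :=
  AEEqFun.coeFn_mk _ _

open Classical in
/-- The density `|weight|^r`, understood as `1` on the support of the weight if `r = 0`. -/
noncomputable def density (r : ℝ≥0∞) (x : ℝ) : ℝ≥0∞ :=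
  if S.weight x = 0 then 0 else ‖S.weight x‖ₑ ^ r.toReal

theorem measurable_density (r : ℝ≥0∞) : Measurable (S.density r) :=
  Measurable.ite (S.measurable_weight (measurableSet_singleton 0)) measurable_const
    (S.measurable_weight.enorm.pow_const _)

theorem density_ne_zero {r : ℝ≥0∞} {x : ℝ} (hx : S.weight x ≠ 0) : S.density r x ≠ 0 := by
  rw [density, if_neg hx]
  exact (ENNReal.rpow_pos (by simpa using hx) (by simp)).ne'

/-- The operator is bounded on `L_r` with norm at most `C ^ (1 / r)`, or at most `C` if `r = 0` or
`r = ∞`. -/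
def Bound (r C : ℝ≥0∞) : Prop :=
  if r = ∞ then ∀ x, ‖S.weight x‖ₑ ≤ C
  else ∀ u : ℝ → ℝ≥0∞, Measurable u →
    ∫⁻ x, S.density r x * u (S.map x) ∂halfLine ≤ C * ∫⁻ x, u x ∂halfLine

/-- The map is nonsingular on the support of the weight. -/
def Nonsingular : Prop :=
  ∀ P : ℝ → Prop, (∀ᵐ x ∂halfLine, P x) → ∀ᵐ x ∂halfLine, S.weight x ≠ 0 → P (S.map x)

variable {S}

theorem Bound.nonsingular {r C : ℝ≥0∞} (h : S.Bound r C) (hr : r ≠ ∞) : S.Nonsingular := by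
  intro P hP
  rw [Bound, if_neg hr] at h
  obtain ⟨N, hPN, hN, hN0⟩ := exists_measurable_superset_of_null (ae_iff.1 hP)
  have h0 := h (N.indicator 1) (measurable_one.indicator hN)
  rw [lintegral_indicator_one hN, hN0, mul_zero, nonpos_iff_eq_zero] at h0
  replace h0 := (lintegral_eq_zero_iff (f := fun x => S.density r x * N.indicator 1 (S.map x))
    ((S.measurable_density r).mul ((measurable_one.indicator hN).comp S.measurable_map))).1 h0
  filter_upwards [h0] with x hx hw
  by_contra hcon
  have hxN : S.map x ∈ N := hPN hcon
  simp [indicator_of_mem hxN, S.density_ne_zero hw] at hx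

theorem Nonsingular.apply_eq (h : S.Nonsingular) {f : MeasFun 𝕜} {f' : ℝ → 𝕜}
    (hf : f =ᵐ[halfLine] f') : S.apply f =ᵐ[halfLine] fun x => S.weight x * f' (S.map x) := by
  filter_upwards [S.coeFn_apply f, h _ hf] with x hx hP
  rw [hx]
  by_cases hw : S.weight x = 0
  · simp [hw]
  · rw [hP hw]

theorem Nonsingular.apply_add (h : S.Nonsingular) (f g : MeasFun 𝕜) :
    S.apply (f + g) = S.apply f + S.apply g := by
  refine AEEqFun.ext ?_
  filter_upwards [h.apply_eq (AEEqFun.coeFn_add f g), AEEqFun.coeFn_add (S.apply f) (S.apply g),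
    S.coeFn_apply f, S.coeFn_apply g] with x hSadd hadd hf hg
  rw [hSadd, hadd, Pi.add_apply, Pi.add_apply, hf, hg, mul_add]

theorem Nonsingular.apply_smul (h : S.Nonsingular) (a : 𝕜) (f : MeasFun 𝕜) :
    S.apply (a • f) = a • S.apply f := by
  refine AEEqFun.ext ?_
  filter_upwards [h.apply_eq (AEEqFun.coeFn_smul a f), AEEqFun.coeFn_smul a (S.apply f),
    S.coeFn_apply f] with x hSsmul hsmul hf
  rw [hSsmul, hsmul, Pi.smul_apply, Pi.smul_apply, hf, smul_eq_mul, smul_eq_mul, mul_left_comm]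

/-- The weighted composition operator as a linear map. -/
noncomputable def Nonsingular.toLinearMap (h : S.Nonsingular) : MeasFun 𝕜 →ₗ[𝕜] MeasFun 𝕜 where
  toFun := S.apply
  map_add' := h.apply_add
  map_smul' := h.apply_smul

theorem Nonsingular.apply_zero (h : S.Nonsingular) : S.apply 0 = 0 := map_zero h.toLinearMap

theorem Nonsingular.apply_sub (h : S.Nonsingular) (f g : MeasFun 𝕜) :
    S.apply (f - g) = S.apply f - S.apply g := map_sub h.toLinearMap f g

theorem Nonsingular.apply_sum (h : S.Nonsingular) (s : Finset ℕ) (v : ℕ → MeasFun 𝕜) :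
    S.apply (∑ n ∈ s, v n) = ∑ n ∈ s, S.apply (v n) := map_sum h.toLinearMap v s

theorem enorm_weight_mul_rpow {r : ℝ≥0∞} (hr : 0 < r.toReal) (x : ℝ) (c : 𝕜) :
    ‖S.weight x * c‖ₑ ^ r.toReal = S.density r x * ‖c‖ₑ ^ r.toReal := by
  rw [enorm_mul, ENNReal.mul_rpow_of_nonneg _ _ hr.le, density]
  split_ifs with h0
  · simp [h0, hr]
  · rfl

end WeightedComp

section LSpace

variable {𝕜 : Type*} [RCLike 𝕜]

theorem mem_LSpace_zero {f : MeasFun 𝕜} :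
    f ∈ (LSpace 𝕜 0).carrier ↔ halfLine {x | f x ≠ 0} < ∞ := by
  rw [LSpace, if_pos rfl]
  rfl

theorem size_LSpace_zero (f : MeasFun 𝕜) :
    (LSpace 𝕜 0).size f = (halfLine {x | f x ≠ 0}).toReal := by
  rw [LSpace, if_pos rfl]
  rfl

theorem mem_LSpace {r : ℝ≥0∞} (hr : r ≠ 0) {f : MeasFun 𝕜} :
    f ∈ (LSpace 𝕜 r).carrier ↔ eLpNorm f r halfLine < ∞ := by
  rw [LSpace, if_neg hr]
  rfl

theorem size_LSpace {r : ℝ≥0∞} (hr : r ≠ 0) (f : MeasFun 𝕜) :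
    (LSpace 𝕜 r).size f = (eLpNorm f r halfLine).toReal := by
  rw [LSpace, if_neg hr]

namespace WeightedComp

variable {S : WeightedComp 𝕜}

theorem Bound.eLpNorm_apply_le {r C : ℝ≥0∞} (h : S.Bound r C) (hns : S.Nonsingular) (hr : r ≠ 0)
    (f : MeasFun 𝕜) :
    eLpNorm (S.apply f) r halfLine ≤ C ^ (if r = ∞ then 1 else 1 / r.toReal) *
      eLpNorm f r halfLine := by
  rw [eLpNorm_congr_ae (S.coeFn_apply f)]
  by_cases hrt : r = ∞
  · rw [Bound, if_pos hrt] at h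
    rw [if_pos hrt, ENNReal.rpow_one, hrt, eLpNorm_exponent_top, eLpNorm_exponent_top]
    refine eLpNormEssSup_le_of_ae_enorm_bound ?_
    filter_upwards [hns _ (enorm_ae_le_eLpNormEssSup f halfLine)] with x hx
    rw [enorm_mul]
    by_cases hw : S.weight x = 0
    · simp [hw]
    · exact mul_le_mul' (h x) (hx hw)
  · rw [Bound, if_neg hrt] at h
    have hr0 : 0 < r.toReal := ENNReal.toReal_pos hr hrt
    rw [if_neg hrt, eLpNorm_eq_lintegral_rpow_enorm_toReal hr hrt,
      eLpNorm_eq_lintegral_rpow_enorm_toReal hr hrt,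
      ← ENNReal.mul_rpow_of_nonneg _ _ (by positivity)]
    refine ENNReal.rpow_le_rpow ?_ (by positivity)
    simp_rw [enorm_weight_mul_rpow hr0]
    exact h (fun x => ‖f x‖ₑ ^ r.toReal) (f.stronglyMeasurable.measurable.enorm.pow_const _)

theorem Bound.measure_support_apply_le {C : ℝ≥0∞} (h : S.Bound 0 C) (f : MeasFun 𝕜) :
    halfLine {x | S.apply f x ≠ 0} ≤ C * halfLine {x | f x ≠ 0} := by
  rw [Bound, if_neg ENNReal.zero_ne_top] at h
  have hm : MeasurableSet {x | f x ≠ 0} :=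
    (f.stronglyMeasurable.measurable (measurableSet_singleton 0)).compl
  have hm' : MeasurableSet {x | S.apply f x ≠ 0} :=
    ((S.apply f).stronglyMeasurable.measurable (measurableSet_singleton 0)).compl
  have hsupp := h ({x | f x ≠ 0}.indicator 1) (measurable_one.indicator hm)
  rw [lintegral_indicator_one hm] at hsupp
  refine le_trans ?_ hsupp
  rw [← lintegral_indicator_one hm']
  refine lintegral_mono_ae ?_
  filter_upwards [S.coeFn_apply f] with x hx
  by_cases hne : S.apply f x = 0
  · rw [indicator_of_notMem (by simpa using hne)]
    exact zero_le
  · rw [indicator_of_mem (show x ∈ {x | S.apply f x ≠ 0} from hne)]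
    rw [hx] at hne
    rw [indicator_of_mem (show S.map x ∈ {x | f x ≠ 0} from right_ne_zero_of_mul hne), density,
      if_neg (left_ne_zero_of_mul hne)]
    simp

theorem Bound.exists_bound_LSpace {r C : ℝ≥0∞} (h : S.Bound r C) (hC : C ≠ ∞)
    (hns : S.Nonsingular) :
    ∃ K : ℝ, ∀ f ∈ (LSpace 𝕜 r).carrier, S.apply f ∈ (LSpace 𝕜 r).carrier ∧
      (LSpace 𝕜 r).size (S.apply f) ≤ K * (LSpace 𝕜 r).size f := by
  by_cases hr : r = 0
  · subst hr
    refine ⟨C.toReal, fun f hf => ?_⟩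
    rw [mem_LSpace_zero] at hf
    have hlt : C * halfLine {x | f x ≠ 0} < ∞ := ENNReal.mul_lt_top hC.lt_top hf
    rw [mem_LSpace_zero, size_LSpace_zero, size_LSpace_zero, ← ENNReal.toReal_mul]
    exact ⟨(h.measure_support_apply_le f).trans_lt hlt,
      ENNReal.toReal_mono hlt.ne (h.measure_support_apply_le f)⟩
  · have hK : C ^ (if r = ∞ then 1 else 1 / r.toReal) ≠ ∞ :=
      ENNReal.rpow_ne_top_of_nonneg (by split_ifs <;> positivity) hC
    refine ⟨(C ^ (if r = ∞ then 1 else 1 / r.toReal)).toReal, fun f hf => ?_⟩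
    rw [mem_LSpace hr] at hf
    have hlt := ENNReal.mul_lt_top hK.lt_top hf
    rw [mem_LSpace hr, size_LSpace hr, size_LSpace hr, ← ENNReal.toReal_mul]
    exact ⟨(h.eLpNorm_apply_le hns hr f).trans_lt hlt,
      ENNReal.toReal_mono hlt.ne (h.eLpNorm_apply_le hns hr f)⟩

theorem exists_bound_of_isInterpolationSpace {p q C : ℝ≥0∞} (hp : p ≠ ∞) {E : SizedSpace 𝕜}
    (hE : IsInterpolationSpace (LSpace 𝕜 p) (LSpace 𝕜 q) E) (h₁ : S.Bound p C) (h₂ : S.Bound q C)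
    (hC : C ≠ ∞) :
    ∃ K : ℝ, ∀ f ∈ E.carrier, S.apply f ∈ E.carrier ∧ E.size (S.apply f) ≤ K * E.size f := by
  have hns := h₁.nonsingular hp
  obtain ⟨K₁, hK₁⟩ := h₁.exists_bound_LSpace hC hns
  obtain ⟨K₂, hK₂⟩ := h₂.exists_bound_LSpace hC hns
  have hmem : ∀ f ∈ (LSpace 𝕜 p).carrier ⊔ (LSpace 𝕜 q).carrier,
      S.apply f ∈ (LSpace 𝕜 p).carrier ⊔ (LSpace 𝕜 q).carrier := fun f hf => by
    obtain ⟨a, ha, b, hb, rfl⟩ := Submodule.mem_sup.1 hf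
    rw [hns.apply_add]
    exact Submodule.add_mem_sup (hK₁ a ha).1 (hK₂ b hb).1
  let T : ↥((LSpace 𝕜 p).carrier ⊔ (LSpace 𝕜 q).carrier) →ₗ[𝕜]
      ↥((LSpace 𝕜 p).carrier ⊔ (LSpace 𝕜 q).carrier) :=
    { toFun := fun f => ⟨S.apply f, hmem f f.2⟩
      map_add' := fun f g => Subtype.ext (hns.apply_add f g)
      map_smul' := fun a f => Subtype.ext (hns.apply_smul a f) }
  obtain ⟨K, hK⟩ := hE.2.2 T ⟨⟨K₁, fun f hf => hK₁ f hf⟩, ⟨K₂, fun f hf => hK₂ f hf⟩⟩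
  exact ⟨K, fun f hf => hK ⟨f, hE.2.1 hf⟩ hf⟩

end WeightedComp

end LSpace

/-! ### Copies of the half line -/

/-- The embedding of the half line onto its `n`-th copy, the union over `k` of the unit intervals
starting at `Nat.pair n k`. -/
noncomputable def copyIncl (n : ℕ) (y : ℝ) : ℝ := (Nat.pair n ⌊y⌋₊ : ℝ) + Int.fract y

/-- The index of the copy which contains a point. -/
noncomputable def copyIndex (x : ℝ) : ℕ := (Nat.unpair ⌊x⌋₊).1

/-- The position of a point within its copy. -/
noncomputable def copyPos (x : ℝ) : ℝ := ((Nat.unpair ⌊x⌋₊).2 : ℝ) + Int.fract x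

theorem measurable_copyIncl (n : ℕ) : Measurable (copyIncl n) :=
  ((measurable_from_top (f := fun k : ℕ => (Nat.pair n k : ℝ))).comp Nat.measurable_floor).add
    measurable_fract

theorem measurable_copyIndex : Measurable copyIndex :=
  (measurable_from_top (f := fun k : ℕ => (Nat.unpair k).1)).comp Nat.measurable_floor

theorem measurable_copyPos : Measurable copyPos :=
  ((measurable_from_top (f := fun k : ℕ => ((Nat.unpair k).2 : ℝ))).comp Nat.measurable_floor).add
    measurable_fract

theorem floor_copyIncl (n : ℕ) (y : ℝ) : ⌊copyIncl n y⌋₊ = Nat.pair n ⌊y⌋₊ := by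
  rw [copyIncl, Nat.floor_eq_iff (by have := Int.fract_nonneg y; positivity)]
  constructor <;> linarith [Int.fract_nonneg y, Int.fract_lt_one y]

theorem copyIndex_copyIncl (n : ℕ) (y : ℝ) : copyIndex (copyIncl n y) = n := by
  rw [copyIndex, floor_copyIncl, Nat.unpair_pair]

theorem copyPos_copyIncl (n : ℕ) {y : ℝ} (hy : 0 ≤ y) : copyPos (copyIncl n y) = y := by
  rw [copyPos, floor_copyIncl, Nat.unpair_pair, copyIncl, Int.fract_natCast_add, Int.fract_fract,
    natCast_floor_eq_intCast_floor hy, Int.floor_add_fract]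

theorem ae_halfLine_pos : ∀ᵐ x ∂halfLine, 0 < x := ae_restrict_mem measurableSet_Ioi

theorem lintegral_halfLine_eq_tsum {u : ℝ → ℝ≥0∞} (hu : Measurable u) :
    ∫⁻ x, u x ∂halfLine = ∑' j : ℕ, ∫⁻ t in Ico (0 : ℝ) 1, u (j + t) := by
  have hunion : Ici (0 : ℝ) = ⋃ j : ℕ, Ico (j : ℝ) (j + 1) := by
    ext x
    simp only [mem_Ici, mem_iUnion, mem_Ico]
    exact ⟨fun hx => ⟨⌊x⌋₊, Nat.floor_le hx, Nat.lt_floor_add_one x⟩,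
      fun ⟨j, hj, _⟩ => le_trans (Nat.cast_nonneg j) hj⟩
  have hdisj : Pairwise (Function.onFun Disjoint fun j : ℕ => Ico (j : ℝ) (j + 1)) := by
    intro i j hij
    refine Set.disjoint_left.2 fun x hi hj => hij ?_
    have hx : 0 ≤ x := le_trans (Nat.cast_nonneg i) hi.1
    rw [← (Nat.floor_eq_iff hx).2 hi, ← (Nat.floor_eq_iff hx).2 hj]
  rw [halfLine, restrict_Ioi_eq_restrict_Ici, hunion,
    lintegral_iUnion (fun _ => measurableSet_Ico) hdisj]
  refine tsum_congr fun j => ?_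
  rw [← (measurePreserving_add_left volume (j : ℝ)).setLIntegral_comp_preimage measurableSet_Ico hu]
  congr 2
  ext t
  simp

theorem lintegral_halfLine_eq_tsum_copyIncl {u : ℝ → ℝ≥0∞} (hu : Measurable u) :
    ∫⁻ x, u x ∂halfLine = ∑' n : ℕ, ∫⁻ y, u (copyIncl n y) ∂halfLine := by
  have hcopy : ∀ n, ∫⁻ y, u (copyIncl n y) ∂halfLine =
      ∑' k : ℕ, ∫⁻ t in Ico (0 : ℝ) 1, u ((Nat.pair n k : ℕ) + t) := fun n => by
    rw [lintegral_halfLine_eq_tsum (u := fun y => u (copyIncl n y))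
      (hu.comp (measurable_copyIncl n))]
    refine tsum_congr fun k => setLIntegral_congr_fun measurableSet_Ico fun t ht => ?_
    have hfl : ⌊(k : ℝ) + t⌋₊ = k := by
      rw [Nat.floor_eq_iff (by linarith [ht.1, (Nat.cast_nonneg k : (0 : ℝ) ≤ k)])]
      constructor <;> linarith [ht.1, ht.2]
    simp only [copyIncl, hfl, Int.fract_natCast_add, Int.fract_eq_self.2 ht]
  simp_rw [hcopy]
  rw [lintegral_halfLine_eq_tsum hu, ← ENNReal.tsum_prod (f := fun n k =>
    ∫⁻ t in Ico (0 : ℝ) 1, u ((Nat.pair n k : ℕ) + t)), ← Nat.pairEquiv.tsum_eq]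
  rfl

namespace WeightedComp

variable {𝕜 : Type*} [RCLike 𝕜]

/-- Extension of a function from the half line to its `n`-th copy, by zero elsewhere. -/
noncomputable def toCopy (𝕜 : Type*) [RCLike 𝕜] (n : ℕ) : WeightedComp 𝕜 where
  weight x := if copyIndex x = n then 1 else 0
  map := copyPos
  measurable_weight := Measurable.ite (measurable_copyIndex (measurableSet_singleton n))
    measurable_const measurable_const
  measurable_map := measurable_copyPos

/-- Restriction of a function to the `n`-th copy of the half line. -/
noncomputable def fromCopy (𝕜 : Type*) [RCLike 𝕜] (n : ℕ) : WeightedComp 𝕜 where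
  weight _ := 1
  map := copyIncl n
  measurable_weight := measurable_const
  measurable_map := measurable_copyIncl n

theorem measurable_comp_copy {β : Type*} [MeasurableSpace β] {F : ℕ → ℝ → β}
    (hF : ∀ n, Measurable (F n)) : Measurable fun x => F (copyIndex x) (copyPos x) := by
  have h : Measurable fun z : ℕ × ℝ => F z.1 z.2 := measurable_from_prod_countable_right hF
  have h' : Measurable fun x => (copyIndex x, copyPos x) :=
    measurable_copyIndex.prodMk measurable_copyPos
  exact Measurable.comp (g := fun z : ℕ × ℝ => F z.1 z.2) h h'

/-- The direct sum of a sequence of weighted composition operators acting on the copies. -/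
noncomputable def glue (S : ℕ → WeightedComp 𝕜) : WeightedComp 𝕜 where
  weight x := (S (copyIndex x)).weight (copyPos x)
  map x := copyIncl (copyIndex x) ((S (copyIndex x)).map (copyPos x))
  measurable_weight :=
    measurable_comp_copy (F := fun n => (S n).weight) fun n => (S n).measurable_weight
  measurable_map :=
    measurable_comp_copy (F := fun n y => copyIncl n ((S n).map y)) fun n =>
      (measurable_copyIncl n).comp (S n).measurable_map

theorem bound_toCopy (n : ℕ) (r : ℝ≥0∞) : (toCopy 𝕜 n).Bound r 1 := by
  rw [Bound]
  split_ifs with hr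
  · intro x
    change ‖(if copyIndex x = n then 1 else 0 : 𝕜)‖ₑ ≤ 1
    split_ifs <;> simp
  · intro u hu
    rw [lintegral_halfLine_eq_tsum_copyIncl
      (u := fun x => (toCopy 𝕜 n).density r x * u ((toCopy 𝕜 n).map x))
      (((toCopy 𝕜 n).measurable_density r).mul (hu.comp (toCopy 𝕜 n).measurable_map)), one_mul,
      tsum_eq_single n]
    · refine lintegral_mono_ae ?_
      filter_upwards [ae_halfLine_pos] with y hy
      simp [density, toCopy, copyIndex_copyIncl, copyPos_copyIncl n hy.le]
    · intro k hk
      simp [density, toCopy, copyIndex_copyIncl, hk]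

theorem bound_fromCopy (n : ℕ) (r : ℝ≥0∞) : (fromCopy 𝕜 n).Bound r 1 := by
  rw [Bound]
  split_ifs with hr
  · intro x
    simp [fromCopy]
  · intro u hu
    rw [lintegral_halfLine_eq_tsum_copyIncl hu, one_mul]
    refine le_trans (le_of_eq ?_) (ENNReal.le_tsum n)
    simp [density, fromCopy]

theorem bound_glue {S : ℕ → WeightedComp 𝕜} {r C : ℝ≥0∞} (h : ∀ n, (S n).Bound r C) :
    (glue S).Bound r C := by
  rw [Bound]
  split_ifs with hr
  · intro x
    have := h (copyIndex x)
    rw [Bound, if_pos hr] at this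
    exact this _
  · intro u hu
    rw [lintegral_halfLine_eq_tsum_copyIncl
      (u := fun x => (glue S).density r x * u ((glue S).map x))
      (((glue S).measurable_density r).mul (hu.comp (glue S).measurable_map)),
      lintegral_halfLine_eq_tsum_copyIncl hu, ← ENNReal.tsum_mul_left]
    refine ENNReal.tsum_le_tsum fun n => ?_
    have hn := h n
    rw [Bound, if_neg hr] at hn
    refine le_trans (le_of_eq (lintegral_congr_ae ?_)) (hn _ (hu.comp (measurable_copyIncl n)))
    filter_upwards [ae_halfLine_pos] with y hy
    simp [density, glue, copyIndex_copyIncl, copyPos_copyIncl n hy.le]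

theorem nonsingular_fromCopy (n : ℕ) : (fromCopy 𝕜 n).Nonsingular :=
  (bound_fromCopy n 0).nonsingular ENNReal.zero_ne_top

theorem fromCopy_toCopy_self (n : ℕ) (f : MeasFun 𝕜) :
    (fromCopy 𝕜 n).apply ((toCopy 𝕜 n).apply f) = f := by
  refine AEEqFun.ext ?_
  filter_upwards [(nonsingular_fromCopy n).apply_eq ((toCopy 𝕜 n).coeFn_apply f),
    ae_halfLine_pos] with x hx hx0
  rw [hx]
  simp [fromCopy, toCopy, copyIndex_copyIncl, copyPos_copyIncl n hx0.le]

theorem fromCopy_toCopy_of_ne {n k : ℕ} (hnk : n ≠ k) (f : MeasFun 𝕜) :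
    (fromCopy 𝕜 n).apply ((toCopy 𝕜 k).apply f) = 0 := by
  refine AEEqFun.ext ?_
  filter_upwards [(nonsingular_fromCopy n).apply_eq ((toCopy 𝕜 k).coeFn_apply f),
    AEEqFun.coeFn_zero (μ := halfLine) (α := ℝ) (β := 𝕜)] with x hx hx0
  rw [hx, hx0]
  simp [fromCopy, toCopy, copyIndex_copyIncl, hnk]

theorem fromCopy_glue {S : ℕ → WeightedComp 𝕜} (hS : ∀ n, (S n).Nonsingular) (n : ℕ)
    (f : MeasFun 𝕜) :
    (fromCopy 𝕜 n).apply ((glue S).apply f) = (S n).apply ((fromCopy 𝕜 n).apply f) := by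
  refine AEEqFun.ext ?_
  filter_upwards [(nonsingular_fromCopy n).apply_eq ((glue S).coeFn_apply f),
    (hS n).apply_eq ((fromCopy 𝕜 n).coeFn_apply f), ae_halfLine_pos] with x hfrom happly hx0
  rw [hfrom, happly]
  simp [fromCopy, glue, copyIndex_copyIncl, copyPos_copyIncl n hx0.le]

end WeightedComp

namespace QuasiBanachFunctionSpace

variable {𝕜 : Type*} [RCLike 𝕜] (E : QuasiBanachFunctionSpace 𝕜)

theorem exists_quasi_triangle : ∃ K : ℝ, 1 ≤ K ∧ ∀ f ∈ E.carrier, ∀ g ∈ E.carrier,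
    E.size (f + g) ≤ K * (E.size f + E.size g) := by
  obtain ⟨C, hC⟩ := E.size_add_le
  refine ⟨max C 1, le_max_right _ _, fun f hf g hg => (hC f hf g hg).trans ?_⟩
  exact mul_le_mul_of_nonneg_right (le_max_left _ _)
    (add_nonneg (E.size_nonneg f hf) (E.size_nonneg g hg))

theorem size_neg {f : MeasFun 𝕜} (hf : f ∈ E.carrier) : E.size (-f) = E.size f := by
  rw [← neg_one_smul 𝕜 f, E.size_smul _ _ hf, norm_neg, norm_one, one_mul]

theorem size_zero : E.size 0 = 0 := (E.size_eq_zero_iff 0 E.carrier.zero_mem).2 rfl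

variable {E}

theorem size_sum_range_le {K : ℝ} (hK : 0 < K)
    (htri : ∀ f ∈ E.carrier, ∀ g ∈ E.carrier, E.size (f + g) ≤ K * (E.size f + E.size g))
    {v : ℕ → MeasFun 𝕜} (hv : ∀ n, v n ∈ E.carrier) (hsize : ∀ n, E.size (v n) ≤ (2 * K)⁻¹ ^ n)
    (d M : ℕ) : E.size (∑ i ∈ Finset.range d, v (M + i)) ≤ 2 * K * (2 * K)⁻¹ ^ M := by
  induction d generalizing M with
  | zero =>
    rw [Finset.range_zero, Finset.sum_empty, E.size_zero]
    positivity
  | succ d ih =>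
    have hshift : ∀ i, v (M + (i + 1)) = v (M + 1 + i) := fun i => by rw [add_assoc, add_comm 1]
    simp only [Finset.sum_range_succ', hshift, add_zero]
    calc E.size (∑ i ∈ Finset.range d, v (M + 1 + i) + v M)
        ≤ K * (E.size (∑ i ∈ Finset.range d, v (M + 1 + i)) + E.size (v M)) :=
          htri _ (Submodule.sum_mem _ fun n _ => hv _) _ (hv _)
      _ ≤ K * (2 * K * (2 * K)⁻¹ ^ (M + 1) + (2 * K)⁻¹ ^ M) := by
          gcongr
          exacts [ih (M + 1), hsize M]
      _ = 2 * K * (2 * K)⁻¹ ^ M := by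
          rw [pow_succ]
          field_simp
          ring

theorem exists_tendsto_sum {K : ℝ} (hK : 1 ≤ K)
    (htri : ∀ f ∈ E.carrier, ∀ g ∈ E.carrier, E.size (f + g) ≤ K * (E.size f + E.size g))
    {v : ℕ → MeasFun 𝕜} (hv : ∀ n, v n ∈ E.carrier) (hsize : ∀ n, E.size (v n) ≤ (2 * K)⁻¹ ^ n) :
    ∃ f ∈ E.carrier,
      Tendsto (fun N => E.size (∑ n ∈ Finset.range N, v n - f)) atTop (𝓝 0) := by
  have hmem : ∀ N, ∑ n ∈ Finset.range N, v n ∈ E.carrier := fun N =>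
    Submodule.sum_mem _ fun n _ => hv n
  have hlim : Tendsto (fun M : ℕ => 2 * K * (2 * K)⁻¹ ^ M) atTop (𝓝 0) := by
    simpa only [mul_zero] using (tendsto_pow_atTop_nhds_zero_of_lt_one (by positivity)
      (inv_lt_one_of_one_lt₀ (by linarith))).const_mul (2 * K)
  refine E.complete _ hmem fun ε hε => ?_
  obtain ⟨N, hN⟩ := eventually_atTop.1 (hlim.eventually_lt_const hε)
  have htail : ∀ m ≥ N, ∀ n ≥ m,
      E.size (∑ i ∈ Finset.range n, v i - ∑ i ∈ Finset.range m, v i) < ε := by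
    intro m hm n hn
    obtain ⟨d, rfl⟩ := Nat.exists_eq_add_of_le hn
    rw [Finset.sum_range_add, add_sub_cancel_left]
    exact (size_sum_range_le (by linarith) htri hv hsize d m).trans_lt (hN m hm)
  refine ⟨N, fun m hm n hn => ?_⟩
  rcases le_total m n with h | h
  · rw [← neg_sub, E.size_neg (E.carrier.sub_mem (hmem _) (hmem _))]
    exact htail m hm n h
  · exact htail n hn m h

open WeightedComp

variable {S : WeightedComp 𝕜} {p q C : ℝ≥0∞}

theorem exists_pos_bound (hp : p ≠ ∞)
    (hE : IsInterpolationSpace (LSpace 𝕜 p) (LSpace 𝕜 q) E.toSizedSpace) (h₁ : S.Bound p C)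
    (h₂ : S.Bound q C) (hC : C ≠ ∞) :
    ∃ K : ℝ, 0 < K ∧ ∀ f ∈ E.carrier, S.apply f ∈ E.carrier ∧
      E.size (S.apply f) ≤ K * E.size f := by
  obtain ⟨K, hK⟩ := exists_bound_of_isInterpolationSpace hp hE h₁ h₂ hC
  refine ⟨max K 1, by positivity, fun f hf => ⟨(hK f hf).1, (hK f hf).2.trans ?_⟩⟩
  exact mul_le_mul_of_nonneg_right (le_max_left _ _) (E.size_nonneg f hf)

theorem apply_eq_of_tendsto_size (hS : S.Nonsingular) {d : ℝ}
    (hd : ∀ f ∈ E.carrier, S.apply f ∈ E.carrier ∧ E.size (S.apply f) ≤ d * E.size f)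
    {u : ℕ → MeasFun 𝕜} (hu : ∀ n, u n ∈ E.carrier) {F g : MeasFun 𝕜} (hF : F ∈ E.carrier)
    (hlim : Tendsto (fun n => E.size (u n - F)) atTop (𝓝 0))
    (hg : ∀ᶠ n in atTop, S.apply (u n) = g) : S.apply F = g := by
  obtain ⟨n, hn⟩ := hg.exists
  have hmem : g - S.apply F ∈ E.carrier := E.carrier.sub_mem (hn ▸ (hd _ (hu n)).1) (hd F hF).1
  have hlim' : Tendsto (fun n => d * E.size (u n - F)) atTop (𝓝 0) := by
    simpa only [mul_zero] using hlim.const_mul d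
  have hle : E.size (g - S.apply F) ≤ 0 := by
    refine ge_of_tendsto hlim' (hg.mono fun n hn => ?_)
    rw [← hn, ← hS.apply_sub]
    exact (hd _ (E.carrier.sub_mem (hu n) hF)).2
  have := (E.size_eq_zero_iff _ hmem).1 (hle.antisymm (E.size_nonneg _ hmem))
  exact (sub_eq_zero.1 this).symm

theorem exists_forall_fromCopy_eq (hp : p ≠ ∞)
    (hE : IsInterpolationSpace (LSpace 𝕜 p) (LSpace 𝕜 q) E.toSizedSpace) :
    ∃ ε : ℕ → ℝ, (∀ n, 0 < ε n) ∧ ∀ f : ℕ → MeasFun 𝕜, (∀ n, f n ∈ E.carrier) →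
      (∀ n, E.size (f n) ≤ ε n) → ∃ F ∈ E.carrier, ∀ n, (fromCopy 𝕜 n).apply F = f n := by
  obtain ⟨K, hK, htri⟩ := E.exists_quasi_triangle
  have hto := fun n => exists_pos_bound hp hE (bound_toCopy n p) (bound_toCopy n q)
    ENNReal.one_ne_top
  have hfrom := fun n => exists_bound_of_isInterpolationSpace hp hE (bound_fromCopy n p)
    (bound_fromCopy n q) ENNReal.one_ne_top
  choose c hc0 hc using hto
  choose d hd using hfrom
  refine ⟨fun n => (2 * K)⁻¹ ^ n / c n, fun n => div_pos (by positivity) (hc0 n),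
    fun f hf hsize => ?_⟩
  let v : ℕ → MeasFun 𝕜 := fun n => (toCopy 𝕜 n).apply (f n)
  have hv : ∀ n, v n ∈ E.carrier := fun n => (hc n _ (hf n)).1
  have hvsize : ∀ n, E.size (v n) ≤ (2 * K)⁻¹ ^ n := fun n =>
    (hc n _ (hf n)).2.trans ((le_div_iff₀' (hc0 n)).1 (hsize n))
  obtain ⟨F, hF, hlim⟩ := exists_tendsto_sum hK htri hv hvsize
  refine ⟨F, hF, fun n => apply_eq_of_tendsto_size (nonsingular_fromCopy n) (hd n)
    (fun N => Submodule.sum_mem _ fun k _ => hv k) hF hlim ?_⟩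
  filter_upwards [eventually_gt_atTop n] with N hN
  rw [(nonsingular_fromCopy n).apply_sum, Finset.sum_eq_single n, fromCopy_toCopy_self]
  · exact fun k _ hk => fromCopy_toCopy_of_ne hk.symm _
  · exact fun h => absurd (Finset.mem_range.2 hN) h

theorem exists_size_le_and_lt_size_apply (hS : S.Nonsingular) {f : MeasFun 𝕜} (hf : f ∈ E.carrier)
    (hSf : S.apply f ∈ E.carrier) {ε M : ℝ} (hε : 0 < ε)
    (h : M / ε * E.size f < E.size (S.apply f)) :
    ∃ g ∈ E.carrier, E.size g ≤ ε ∧ M < E.size (S.apply g) := by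
  have hpos : 0 < E.size f := by
    refine (E.size_nonneg f hf).lt_of_ne fun h0 => ?_
    obtain rfl := (E.size_eq_zero_iff f hf).1 h0.symm
    rw [hS.apply_zero, E.size_zero, mul_zero] at h
    exact h.false
  have ha : 0 < ε / E.size f := div_pos hε hpos
  have hnorm : ‖((ε / E.size f : ℝ) : 𝕜)‖ = ε / E.size f := by
    rw [RCLike.norm_ofReal, abs_of_pos ha]
  refine ⟨((ε / E.size f : ℝ) : 𝕜) • f, E.carrier.smul_mem _ hf, ?_, ?_⟩
  · rw [E.size_smul _ _ hf, hnorm, div_mul_cancel₀ _ hpos.ne']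
  · rw [hS.apply_smul, E.size_smul _ _ hSf, hnorm]
    calc M = ε / E.size f * (M / ε * E.size f) := by field_simp
      _ < ε / E.size f * E.size (S.apply f) := mul_lt_mul_of_pos_left h ha

theorem exists_uniform_bound (hp : p ≠ ∞)
    (hE : IsInterpolationSpace (LSpace 𝕜 p) (LSpace 𝕜 q) E.toSizedSpace) (hC : C ≠ ∞) :
    ∃ K : ℝ, 0 < K ∧ ∀ S : WeightedComp 𝕜, S.Bound p C → S.Bound q C → ∀ f ∈ E.carrier,
      S.apply f ∈ E.carrier ∧ E.size (S.apply f) ≤ K * E.size f := by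
  have hfrom := fun n => exists_pos_bound hp hE (bound_fromCopy n p) (bound_fromCopy n q)
    ENNReal.one_ne_top
  choose d hd0 hd using hfrom
  obtain ⟨ε, hε, hglue⟩ := exists_forall_fromCopy_eq hp hE
  by_contra! hcon
  have hbad : ∀ n : ℕ, ∃ S : WeightedComp 𝕜, S.Bound p C ∧ S.Bound q C ∧
      ∃ f ∈ E.carrier, E.size f ≤ ε n ∧ d n * (n + 1) < E.size (S.apply f) := fun n => by
    obtain ⟨S, hSp, hSq, f, hf, hlt⟩ := hcon (d n * (n + 1) / ε n)
      (div_pos (mul_pos (hd0 n) n.cast_add_one_pos) (hε n))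
    obtain ⟨_, -, hmem⟩ := exists_pos_bound hp hE hSp hSq hC
    exact ⟨S, hSp, hSq, exists_size_le_and_lt_size_apply (hSp.nonsingular hp) hf (hmem f hf).1
      (hε n) (hlt (hmem f hf).1)⟩
  choose S hSp hSq f hf hsize hlarge using hbad
  obtain ⟨F, hF, hFf⟩ := hglue f hf hsize
  obtain ⟨_, -, hmem⟩ := exists_pos_bound hp hE (bound_glue hSp) (bound_glue hSq) hC
  obtain ⟨n, hn⟩ := exists_nat_gt (E.size ((glue S).apply F))
  have hcopy := (hd n _ (hmem F hF).1).2
  rw [fromCopy_glue fun n => (hSp n).nonsingular hp, hFf] at hcopy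
  have := lt_of_mul_lt_mul_left ((hlarge n).trans_le hcopy) (hd0 n).le
  linarith

end QuasiBanachFunctionSpace

section Finiteness

variable {𝕜 : Type*} [RCLike 𝕜]

theorem measurable_absPow (f : MeasFun 𝕜) (r : ℝ) : Measurable (absPow f r) :=
  f.stronglyMeasurable.measurable.enorm.pow_const r

theorem absPow_ne_top (f : MeasFun 𝕜) {r : ℝ} (hr : 0 ≤ r) (x : ℝ) : absPow f r x ≠ ∞ :=
  ENNReal.rpow_ne_top_of_nonneg hr enorm_ne_top

theorem lintegral_absPow_lt_top {r : ℝ≥0∞} (hr0 : r ≠ 0) (hr : r ≠ ∞) {f : MeasFun 𝕜}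
    (hf : f ∈ (LSpace 𝕜 r).carrier) : ∫⁻ x, absPow f r.toReal x ∂halfLine < ∞ :=
  lintegral_rpow_enorm_lt_top_of_eLpNorm_lt_top hr0 hr ((mem_LSpace hr0).1 hf)

theorem exists_enorm_le_or_enorm_le {A B : SizedSpace 𝕜} {f : MeasFun 𝕜}
    (hf : f ∈ A.carrier ⊔ B.carrier) :
    ∃ a ∈ A.carrier, ∃ b ∈ B.carrier, ∀ᵐ x ∂halfLine, ‖f x‖ₑ ≤ ‖a x‖ₑ ∨ ‖f x‖ₑ ≤ ‖b x‖ₑ := by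
  obtain ⟨a, ha, b, hb, rfl⟩ := Submodule.mem_sup.1 hf
  refine ⟨(2 : 𝕜) • a, A.carrier.smul_mem 2 ha, (2 : 𝕜) • b, B.carrier.smul_mem 2 hb, ?_⟩
  have htwo : ‖(2 : 𝕜)‖ₑ = 2 := by rw [← ofReal_norm, RCLike.norm_ofNat, ENNReal.ofReal_ofNat]
  filter_upwards [AEEqFun.coeFn_add a b, AEEqFun.coeFn_smul (2 : 𝕜) a,
    AEEqFun.coeFn_smul (2 : 𝕜) b] with x hadd ha' hb'
  rw [hadd, ha', hb', Pi.add_apply, Pi.smul_apply, Pi.smul_apply, enorm_smul, enorm_smul, htwo,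
    two_mul, two_mul]
  rcases le_total ‖a x‖ₑ ‖b x‖ₑ with h | h
  · exact Or.inr ((enorm_add_le _ _).trans (by gcongr))
  · exact Or.inl ((enorm_add_le _ _).trans (by gcongr))

theorem exists_lintegral_absPow_ge_lt_top_of_mem {p r : ℝ≥0∞} (hp0 : p ≠ 0) (hp : p ≠ ∞)
    (hpr : p ≤ r) {f : MeasFun 𝕜} (hf : f ∈ (LSpace 𝕜 r).carrier) :
    ∃ t ≠ ∞, ∫⁻ x in {x | t ≤ absPow f p.toReal x}, absPow f p.toReal x ∂halfLine < ∞ := by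
  have hr0 : r ≠ 0 := fun h => hp0 (le_zero_iff.1 (h ▸ hpr))
  have hp_pos : 0 < p.toReal := ENNReal.toReal_pos hp0 hp
  rcases eq_or_ne r ∞ with rfl | hr
  · have hM : eLpNormEssSup f halfLine < ∞ := eLpNorm_exponent_top (f := f) ▸ (mem_LSpace hr0).1 hf
    set M := eLpNormEssSup f halfLine
    have hMp : M ^ p.toReal ≠ ∞ := ENNReal.rpow_ne_top_of_nonneg hp_pos.le hM.ne
    refine ⟨M ^ p.toReal + 1, by finiteness, ?_⟩
    have hnull : halfLine {x | M ^ p.toReal + 1 ≤ absPow f p.toReal x} = 0 := by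
      refine measure_mono_null (fun x hx => ?_) (ae_iff.1 (enorm_ae_le_eLpNormEssSup f halfLine))
      intro (hle : ‖f x‖ₑ ≤ M)
      have hlt := ENNReal.lt_add_right hMp one_ne_zero
      exact (hlt.trans_le hx).not_ge (ENNReal.rpow_le_rpow hle hp_pos.le)
    rw [setLIntegral_measure_zero _ _ hnull]
    exact ENNReal.zero_lt_top
  · refine ⟨1, ENNReal.one_ne_top, lt_of_le_of_lt ?_ (lintegral_absPow_lt_top hr0 hr hf)⟩
    refine (setLIntegral_mono (measurable_absPow f _) fun x hx => ?_).trans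
      (setLIntegral_le_lintegral _ _)
    have hone : 1 ≤ ‖f x‖ₑ := (ENNReal.rpow_le_rpow_iff hp_pos).1 (by rwa [ENNReal.one_rpow])
    exact ENNReal.rpow_le_rpow_of_exponent_le hone (ENNReal.toReal_mono hr hpr)

theorem exists_lintegral_absPow_ge_lt_top {p q : ℝ≥0∞} (hpq : p < q) (hp0 : p ≠ 0)
    {f : MeasFun 𝕜} (hf : f ∈ (LSpace 𝕜 p).carrier ⊔ (LSpace 𝕜 q).carrier) :
    ∃ t ≠ ∞, ∫⁻ x in {x | t ≤ absPow f p.toReal x}, absPow f p.toReal x ∂halfLine < ∞ := by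
  obtain ⟨a, ha, b, hb, hab⟩ := exists_enorm_le_or_enorm_le hf
  obtain ⟨s, hs, hsa⟩ := exists_lintegral_absPow_ge_lt_top_of_mem hp0 hpq.ne_top le_rfl ha
  obtain ⟨t, ht, htb⟩ := exists_lintegral_absPow_ge_lt_top_of_mem hp0 hpq.ne_top hpq.le hb
  refine ⟨max s t, (max_lt hs.lt_top ht.lt_top).ne, ?_⟩
  have hmeas : ∀ (g : MeasFun 𝕜) (u : ℝ≥0∞), MeasurableSet {x | u ≤ absPow g p.toReal x} :=
    fun g u => measurableSet_le measurable_const (measurable_absPow g _)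
  refine lt_of_le_of_lt ?_ (ENNReal.add_lt_top.2 ⟨hsa, htb⟩)
  rw [← lintegral_indicator (hmeas f _), ← lintegral_indicator (hmeas a s),
    ← lintegral_indicator (hmeas b t),
    ← lintegral_add_left ((measurable_absPow a _).indicator (hmeas a s))]
  refine lintegral_mono_ae ?_
  filter_upwards [hab] with x hx
  by_cases hge : max s t ≤ absPow f p.toReal x
  swap
  · rw [indicator_of_notMem (s := {x | max s t ≤ absPow f p.toReal x}) hge]
    exact zero_le
  rw [indicator_of_mem (s := {x | max s t ≤ absPow f p.toReal x}) hge]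
  obtain ⟨hsx, htx⟩ := max_le_iff.1 hge
  rcases hx with hx | hx
  · have hle : absPow f p.toReal x ≤ absPow a p.toReal x := by unfold absPow; gcongr
    rw [indicator_of_mem (s := {x | s ≤ absPow a p.toReal x}) (hsx.trans hle)]
    exact hle.trans le_self_add
  · have hle : absPow f p.toReal x ≤ absPow b p.toReal x := by unfold absPow; gcongr
    rw [indicator_of_mem (s := {x | t ≤ absPow b p.toReal x}) (htx.trans hle)]
    exact hle.trans le_add_self

theorem min_rpow_le_mul_rpow {r s : ℝ} (hr : 0 ≤ r) (hrs : r ≤ s) (hs : 0 < s) (y t : ℝ≥0∞) :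
    min (y ^ s) t ≤ t ^ (1 - r / s) * y ^ r := by
  have hexp : 0 ≤ 1 - r / s := sub_nonneg.2 ((div_le_one hs).2 hrs)
  calc min (y ^ s) t = min (y ^ s) t ^ (1 - r / s) * min (y ^ s) t ^ (r / s) := by
        rw [← ENNReal.rpow_add_of_nonneg _ _ hexp (by positivity), sub_add_cancel,
          ENNReal.rpow_one]
    _ ≤ t ^ (1 - r / s) * (y ^ s) ^ (r / s) := by
        gcongr
        · exact min_le_right _ _
        · exact min_le_left _ _
    _ = t ^ (1 - r / s) * y ^ r := by rw [← ENNReal.rpow_mul, mul_div_cancel₀ _ hs.ne']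

theorem lintegral_min_absPow_lt_top_of_mem {r q : ℝ≥0∞} (hrq : r ≤ q) (hq0 : q ≠ 0) (hq : q ≠ ∞)
    {f : MeasFun 𝕜} (hf : f ∈ (LSpace 𝕜 r).carrier) {t : ℝ≥0∞} (ht : t ≠ ∞) :
    ∫⁻ x, min (absPow f q.toReal x) t ∂halfLine < ∞ := by
  have hq_pos : 0 < q.toReal := ENNReal.toReal_pos hq0 hq
  rcases eq_or_ne r 0 with rfl | hr0
  · have hsupp : MeasurableSet {x | f x ≠ 0} :=
      (f.stronglyMeasurable.measurable (measurableSet_singleton 0)).compl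
    calc ∫⁻ x, min (absPow f q.toReal x) t ∂halfLine
        ≤ ∫⁻ x, {x | f x ≠ 0}.indicator (fun _ => t) x ∂halfLine := by
          refine lintegral_mono fun x => ?_
          by_cases hx : f x = 0
          · simp only [absPow, hx, enorm_zero, ENNReal.zero_rpow_of_pos hq_pos, zero_min, zero_le]
          · rw [indicator_of_mem (show x ∈ {x | f x ≠ 0} from hx)]
            exact min_le_right _ _
      _ = t * halfLine {x | f x ≠ 0} := lintegral_indicator_const hsupp t
      _ < ∞ := ENNReal.mul_lt_top ht.lt_top (mem_LSpace_zero.1 hf)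
  · have hr : r ≠ ∞ := ne_top_of_le_ne_top hq hrq
    have hrq' : r.toReal ≤ q.toReal := ENNReal.toReal_mono hq hrq
    have hexp : 0 ≤ 1 - r.toReal / q.toReal := sub_nonneg.2 ((div_le_one hq_pos).2 hrq')
    calc ∫⁻ x, min (absPow f q.toReal x) t ∂halfLine
        ≤ ∫⁻ x, t ^ (1 - r.toReal / q.toReal) * absPow f r.toReal x ∂halfLine :=
          lintegral_mono fun x => min_rpow_le_mul_rpow ENNReal.toReal_nonneg hrq' hq_pos _ t
      _ = t ^ (1 - r.toReal / q.toReal) * ∫⁻ x, absPow f r.toReal x ∂halfLine :=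
          lintegral_const_mul _ (measurable_absPow f _)
      _ < ∞ := ENNReal.mul_lt_top (ENNReal.rpow_lt_top_of_nonneg hexp ht)
          (lintegral_absPow_lt_top hr0 hr hf)

theorem lintegral_min_absPow_lt_top {p q : ℝ≥0∞} (hpq : p < q) (hq : q ≠ ∞) {f : MeasFun 𝕜}
    (hf : f ∈ (LSpace 𝕜 p).carrier ⊔ (LSpace 𝕜 q).carrier) {t : ℝ≥0∞} (ht : t ≠ ∞) :
    ∫⁻ x, min (absPow f q.toReal x) t ∂halfLine < ∞ := by
  obtain ⟨a, ha, b, hb, hab⟩ := exists_enorm_le_or_enorm_le hf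
  have hq0 : q ≠ 0 := hpq.ne_bot
  refine lt_of_le_of_lt ?_ (ENNReal.add_lt_top.2
    ⟨lintegral_min_absPow_lt_top_of_mem hpq.le hq0 hq ha ht,
      lintegral_min_absPow_lt_top_of_mem le_rfl hq0 hq hb ht⟩)
  rw [← lintegral_add_left ((measurable_absPow a _).min measurable_const)]
  refine lintegral_mono_ae ?_
  filter_upwards [hab] with x hx
  rcases hx with hx | hx
  · refine le_trans ?_ le_self_add
    unfold absPow
    gcongr
  · refine le_trans ?_ le_add_self
    unfold absPow
    gcongr

end Finiteness

/-! ### Transport of mass between dyadic levels -/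

section DyadicLevel

variable {y z : ℝ≥0∞} {k : ℤ}

/-- The integer `k` such that `2 ^ k ≤ y < 2 ^ (k + 1)`, with the junk value `0` at `y = 0` and
`y = ∞`. -/
noncomputable def dyadicLevel (y : ℝ≥0∞) : ℤ := Int.log 2 y.toReal

theorem measurable_dyadicLevel : Measurable dyadicLevel := by
  have : dyadicLevel = fun y => ⌊Real.logb (2 : ℕ) y.toReal⌋ :=
    funext fun y => (Real.floor_logb_natCast ENNReal.toReal_nonneg).symm
  rw [this]
  exact Int.measurable_floor.comp ((Real.measurable_log.comp ENNReal.measurable_toReal).div_const _)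

theorem two_zpow_ne_top (k : ℤ) : (2 : ℝ≥0∞) ^ k ≠ ∞ :=
  (ENNReal.zpow_lt_top two_ne_zero ENNReal.ofNat_ne_top k).ne

theorem two_zpow_ne_zero (k : ℤ) : (2 : ℝ≥0∞) ^ k ≠ 0 :=
  (ENNReal.zpow_pos two_ne_zero ENNReal.ofNat_ne_top k).ne'

theorem two_zpow_add_one (k : ℤ) : (2 : ℝ≥0∞) ^ (k + 1) = 2 * 2 ^ k := by
  rw [ENNReal.zpow_add two_ne_zero ENNReal.ofNat_ne_top, zpow_one, mul_comm]

theorem toReal_two_zpow (k : ℤ) : ((2 : ℝ≥0∞) ^ k).toReal = ((2 : ℕ) : ℝ) ^ k := by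
  cases k <;> simp

theorem two_zpow_le_iff (hy : y ≠ ∞) : (2 : ℝ≥0∞) ^ k ≤ y ↔ y ≠ 0 ∧ k ≤ dyadicLevel y := by
  rcases eq_or_ne y 0 with rfl | h0
  · simp only [nonpos_iff_eq_zero, two_zpow_ne_zero, ne_eq, not_true_eq_false, false_and]
  · rw [← ENNReal.toReal_le_toReal (two_zpow_ne_top k) hy, toReal_two_zpow,
      Int.zpow_le_iff_le_log one_lt_two (ENNReal.toReal_pos h0 hy), dyadicLevel]
    exact (and_iff_right h0).symm

theorem lt_two_zpow_iff (hy0 : y ≠ 0) (hy : y ≠ ∞) : y < (2 : ℝ≥0∞) ^ k ↔ dyadicLevel y < k := by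
  rw [← not_le, two_zpow_le_iff hy, and_iff_right hy0, not_le]

theorem le_two_pow_mul_of_dyadicLevel_le (hy : y ≠ ∞) (hz0 : z ≠ 0) (hz : z ≠ ∞) (n : ℕ)
    (h : dyadicLevel y ≤ dyadicLevel z + n) : y ≤ 2 ^ (n + 1) * z := by
  rcases eq_or_ne y 0 with rfl | hy0
  · exact zero_le
  calc y ≤ 2 ^ (dyadicLevel z + (n + 1 : ℕ)) :=
        ((lt_two_zpow_iff hy0 hy).2 (by push_cast; omega)).le
    _ = 2 ^ (n + 1) * 2 ^ dyadicLevel z := by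
        rw [ENNReal.zpow_add two_ne_zero ENNReal.ofNat_ne_top, zpow_natCast, mul_comm]
    _ ≤ 2 ^ (n + 1) * z := by
        gcongr
        exact (two_zpow_le_iff hz).2 ⟨hz0, le_rfl⟩

theorem le_of_dyadicLevel_lt (hy0 : y ≠ 0) (hy : y ≠ ∞) (hz0 : z ≠ 0) (hz : z ≠ ∞)
    (h : dyadicLevel z < dyadicLevel y) : z ≤ y :=
  ((lt_two_zpow_iff hz0 hz).2 h).le.trans ((two_zpow_le_iff hy).2 ⟨hy0, le_rfl⟩)

end DyadicLevel

/-- The map `φ` transports the measure `w dm` on `A` into at most `C` times the measure `v dm`. -/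
structure IsTransport (w v : ℝ → ℝ≥0∞) (C : ℝ≥0∞) (A : Set ℝ) (φ : ℝ → ℝ) : Prop where
  measurable : Measurable φ
  map_le : ((halfLine.restrict A).withDensity w).map φ ≤ C • halfLine.withDensity v

section Transport

variable {A B : Set ℝ} {C : ℝ≥0∞} {w v F G : ℝ → ℝ≥0∞}

theorem withDensity_restrict_mono {μ : Measure ℝ} (h : A ⊆ B) (w : ℝ → ℝ≥0∞) :
    (μ.restrict A).withDensity w ≤ (μ.restrict B).withDensity w := by
  refine Measure.le_iff.2 fun s hs => ?_
  rw [withDensity_apply _ hs, withDensity_apply _ hs]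
  exact lintegral_mono' (Measure.restrict_mono le_rfl (Measure.restrict_mono h le_rfl)) le_rfl

theorem IsTransport.mono_set {φ : ℝ → ℝ} (h : IsTransport w v C B φ) (hAB : A ⊆ B) :
    IsTransport w v C A φ :=
  ⟨h.measurable, (Measure.map_mono (withDensity_restrict_mono hAB w) h.measurable).trans h.map_le⟩

theorem withDensity_restrict_apply (A : Set ℝ) (hB : MeasurableSet B) (w : ℝ → ℝ≥0∞) :
    ((halfLine.restrict A).withDensity w) B = ∫⁻ x in A ∩ B, w x ∂halfLine := by
  rw [withDensity_apply _ hB, Measure.restrict_restrict hB, inter_comm]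

theorem exists_isTransport_of_levels {κ l : ℝ → ℤ} (hA : MeasurableSet A) (hB : MeasurableSet B)
    (hC : C ≠ ∞) (hw : Measurable w) (hκ : Measurable κ) (hl : Measurable l)
    (hle : ∀ k, ∫⁻ x in A ∩ {x | k ≤ κ x}, w x ∂halfLine
      ≤ C * ∫⁻ x in B ∩ {x | k ≤ l x}, v x ∂halfLine)
    (hfin : ∀ k, ∫⁻ x in B ∩ {x | k ≤ l x}, v x ∂halfLine ≠ ∞) :
    ∃ φ, IsTransport w v C A φ ∧
      ∀ᵐ x ∂halfLine, x ∈ A → w x ≠ 0 → φ x ∈ B ∧ κ x ≤ l (φ x) := by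
  set μ := (halfLine.restrict A).withDensity w
  set ν := (halfLine.restrict B).withDensity v
  have hμ_apply : ∀ k, μ {x | k ≤ κ x} = ∫⁻ x in A ∩ {x | k ≤ κ x}, w x ∂halfLine := fun k =>
    withDensity_restrict_apply A (hκ measurableSet_Ici) w
  have hν_apply : ∀ k, (C • ν) {x | k ≤ l x} = C * ∫⁻ x in B ∩ {x | k ≤ l x}, v x ∂halfLine :=
    fun k => congrArg (C * ·) (withDensity_restrict_apply B (hl measurableSet_Ici) v)
  have : NullSingletonClass μ :=
    ⟨fun x => withDensity_absolutelyContinuous _ _ (measure_singleton x)⟩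
  obtain ⟨φ, hφ, hmap, hlevel⟩ := exists_map_le_and_le_level (μ := μ) (ν := C • ν) hκ hl
    (fun k => (hμ_apply k).trans_le ((hle k).trans_eq (hν_apply k).symm))
    (fun k => (hν_apply k).trans_ne (ENNReal.mul_ne_top hC (hfin k)))
  refine ⟨φ, ⟨hφ, hmap.trans ?_⟩, ?_⟩
  · gcongr
    simpa only [Measure.restrict_univ] using withDensity_restrict_mono (subset_univ B) v
  · have hB_ae : ∀ᵐ y ∂(C • ν), y ∈ B := Measure.ae_smul_measure
      ((withDensity_absolutelyContinuous _ _).ae_le (ae_restrict_mem hB)) C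
    have hφ_ae := (ae_of_ae_map hφ.aemeasurable (ae_mono hmap hB_ae)).and hlevel
    exact (ae_restrict_iff' hA).1 ((ae_withDensity_iff hw).1 hφ_ae)

theorem exists_isTransport_of_measure_eq_top (hB : MeasurableSet B) (h : halfLine B = ∞)
    (A : Set ℝ) : ∃ φ, IsTransport 1 1 1 A φ ∧ ∀ᵐ x ∂halfLine, φ x ∈ B := by
  have hIic : ∀ x, halfLine (Iic x) ≠ ∞ := fun x => by
    rw [Measure.restrict_apply measurableSet_Iic, inter_comm, Ioi_inter_Iic]
    exact measure_Ioc_lt_top.ne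
  obtain ⟨φ, hφ, hmap, -⟩ := exists_map_le hIic
    (fun x => ne_top_of_le_ne_top (hIic x) (Measure.restrict_le_self (s := B) _))
    (by rw [Measure.restrict_apply_univ B, h]; exact le_top)
  refine ⟨φ, ⟨hφ, ?_⟩, ae_of_ae_map hφ.aemeasurable (ae_mono hmap (ae_restrict_mem hB))⟩
  rw [withDensity_one, withDensity_one, one_smul]
  exact (Measure.map_mono Measure.restrict_le_self hφ).trans (hmap.trans Measure.restrict_le_self)

theorem exists_inter_Ici_eq_Ici {D : Set ℤ} (hD : IsUpperSet D) (hne : D.Nonempty) (k : ℤ) :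
    ∃ i ∈ D, D ∩ Ici k = Ici i := by
  obtain ⟨j, hj⟩ := hne
  obtain ⟨i, hi, hmin⟩ := Int.exists_least_of_bdd (P := fun i => i ∈ D ∩ Ici k)
    ⟨k, fun _ hi => hi.2⟩ ⟨max j k, hD (le_max_left j k) hj, le_max_right j k⟩
  exact ⟨i, hi.1, Subset.antisymm hmin fun j hij => ⟨hD hij hi.1, le_trans (mem_Ici.1 hi.2) hij⟩⟩

theorem setLIntegral_le_of_ne_zero {μ : Measure ℝ} (hA : MeasurableSet A) (hB : MeasurableSet B)
    (h : ∀ x ∈ A, w x ≠ 0 → x ∈ B) : ∫⁻ x in A, w x ∂μ ≤ ∫⁻ x in B, w x ∂μ := by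
  rw [← lintegral_indicator hA, ← lintegral_indicator hB]
  refine lintegral_mono fun x => indicator_apply_le (M := ℝ≥0∞) fun hx => ?_
  rcases eq_or_ne (w x) 0 with h0 | h0
  · exact h0.trans_le zero_le
  · rw [indicator_of_mem (h x hx h0)]

theorem exists_isTransport_of_lintegral_ge_le (hG : Measurable G) (hF : Measurable F)
    (hG_top : ∀ x, G x ≠ ∞) (hF_top : ∀ x, F x ≠ ∞) (hC : C ≠ ∞) {D : Set ℤ} (hD : IsUpperSet D)
    (hne : D.Nonempty)
    (hle : ∀ k ∈ D, ∫⁻ x in {x | 2 ^ (k + 1) ≤ G x}, G x ∂halfLine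
      ≤ C * ∫⁻ x in {x | 2 ^ k ≤ F x}, F x ∂halfLine)
    (hfin : ∀ k ∈ D, ∫⁻ x in {x | 2 ^ k ≤ F x}, F x ∂halfLine ≠ ∞) :
    ∃ φ, IsTransport G F C {x | dyadicLevel (G x) - 1 ∈ D} φ ∧
      ∀ᵐ x ∂halfLine, dyadicLevel (G x) - 1 ∈ D → G x ≤ 4 * F (φ x) := by
  have hκ : Measurable fun x => dyadicLevel (G x) - 1 :=
    (measurable_dyadicLevel.comp hG).sub_const 1
  have hl : Measurable fun x => dyadicLevel (F x) := measurable_dyadicLevel.comp hF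
  have hA : MeasurableSet {x | dyadicLevel (G x) - 1 ∈ D} := hκ (.of_discrete (s := D))
  have hB : MeasurableSet {x | F x ≠ 0 ∧ dyadicLevel (F x) ∈ D} :=
    (hF (measurableSet_singleton 0)).compl.inter (hl (.of_discrete (s := D)))
  have hlevels : ∀ k, ∃ i ∈ D, D ∩ Ici k = Ici i ∧
      {x | F x ≠ 0 ∧ dyadicLevel (F x) ∈ D} ∩ {x | k ≤ dyadicLevel (F x)} = {x | 2 ^ i ≤ F x} := by
    intro k
    obtain ⟨i, hi, hIci⟩ := exists_inter_Ici_eq_Ici hD hne k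
    refine ⟨i, hi, hIci, ext fun x => ?_⟩
    exact and_assoc.trans ((and_congr_right fun _ =>
      Set.ext_iff.1 hIci (dyadicLevel (F x))).trans (two_zpow_le_iff (hF_top x)).symm)
  have hle_level (k : ℤ) :
      ∫⁻ x in {x | dyadicLevel (G x) - 1 ∈ D} ∩ {x | k ≤ dyadicLevel (G x) - 1}, G x ∂halfLine
        ≤ C * ∫⁻ x in {x | F x ≠ 0 ∧ dyadicLevel (F x) ∈ D} ∩ {x | k ≤ dyadicLevel (F x)}, F x
          ∂halfLine := by
    obtain ⟨i, hi, hIci, hset⟩ := hlevels k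
    rw [hset]
    refine le_trans (setLIntegral_le_of_ne_zero (hA.inter (hκ measurableSet_Ici))
      (measurableSet_le measurable_const hG) fun x hx h0 => ?_) (hle i hi)
    have : i ≤ dyadicLevel (G x) - 1 := hIci.subset hx
    exact (two_zpow_le_iff (hG_top x)).2 ⟨h0, le_sub_iff_add_le.1 this⟩
  obtain ⟨φ, hφ, hφ_level⟩ := exists_isTransport_of_levels hA hB hC hG hκ hl hle_level fun k =>
    let ⟨i, hi, _, hset⟩ := hlevels k
    hset ▸ hfin i hi
  refine ⟨φ, hφ, ?_⟩
  filter_upwards [hφ_level] with x hx hxD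
  rcases eq_or_ne (G x) 0 with h0 | h0
  · exact h0.trans_le zero_le
  obtain ⟨⟨hF0, -⟩, hle⟩ := hx hxD h0
  have := le_two_pow_mul_of_dyadicLevel_le (hG_top x) hF0 (hF_top _) 1 (sub_le_iff_le_add.1 hle)
  rwa [show (2 : ℝ≥0∞) ^ (1 + 1) = 4 by norm_num] at this

theorem measurableSet_ne_zero_imp_dyadicLevel_mem (hG : Measurable G) (D : Set ℤ) :
    MeasurableSet {x | G x ≠ 0 → dyadicLevel (G x) ∈ D} := by
  simp only [imp_iff_not_or, not_not]
  exact (hG (measurableSet_singleton 0)).union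
    (measurable_dyadicLevel.comp hG (.of_discrete (s := D)))

theorem setLIntegral_neg_dyadicLevel (hF : Measurable F) (hF_top : ∀ x, F x ≠ ∞) (k : ℤ) :
    ∫⁻ x in {x | F x ≠ 0} ∩ {x | k ≤ -dyadicLevel (F x) - 1}, F x ∂halfLine
      = ∫⁻ x in {x | F x < 2 ^ (-k)}, F x ∂halfLine := by
  have hlt : MeasurableSet {x | F x < 2 ^ (-k)} := measurableSet_lt hF measurable_const
  have hB : MeasurableSet ({x | F x ≠ 0} ∩ {x | k ≤ -dyadicLevel (F x) - 1}) :=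
    (hF (measurableSet_singleton 0)).compl.inter
      (((measurable_dyadicLevel.comp hF).neg.sub_const 1) measurableSet_Ici)
  refine le_antisymm (setLIntegral_le_of_ne_zero hB hlt fun x hx h0 => ?_)
    (setLIntegral_le_of_ne_zero hlt hB fun x hx h0 => ⟨h0, ?_⟩)
  · have : k ≤ -dyadicLevel (F x) - 1 := hx.2
    exact (lt_two_zpow_iff h0 (hF_top x)).2 (by omega)
  · have : dyadicLevel (F x) < -k := (lt_two_zpow_iff h0 (hF_top x)).1 hx
    exact show k ≤ -dyadicLevel (F x) - 1 by omega

theorem exists_isTransport_of_lintegral_lt_le (hG : Measurable G) (hF : Measurable F)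
    (hG_top : ∀ x, G x ≠ ∞) (hF_top : ∀ x, F x ≠ ∞) (hC : C ≠ ∞) (D : Set ℤ)
    (hle : ∀ k ∈ D, ∫⁻ x in {x | G x < 2 ^ (k + 1)}, G x ∂halfLine
      ≤ C * ∫⁻ x in {x | F x < 2 ^ k}, F x ∂halfLine)
    (hfin : ∀ k : ℤ, ∫⁻ x in {x | F x < 2 ^ k}, F x ∂halfLine ≠ ∞) :
    ∃ φ, IsTransport G F C {x | G x ≠ 0 → dyadicLevel (G x) ∈ D} φ ∧
      ∀ᵐ x ∂halfLine, G x ≠ 0 → dyadicLevel (G x) ∈ D → F (φ x) ≠ 0 ∧ F (φ x) ≤ G x := by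
  have hκ : Measurable fun x => -dyadicLevel (G x) := (measurable_dyadicLevel.comp hG).neg
  have hl : Measurable fun x => -dyadicLevel (F x) - 1 :=
    (measurable_dyadicLevel.comp hF).neg.sub_const 1
  have hA := measurableSet_ne_zero_imp_dyadicLevel_mem hG D
  have hB : MeasurableSet {x | F x ≠ 0} := (hF (measurableSet_singleton 0)).compl
  have hlevel_eq := setLIntegral_neg_dyadicLevel hF hF_top
  have hle_level (k : ℤ) :
      ∫⁻ x in {x | G x ≠ 0 → dyadicLevel (G x) ∈ D} ∩ {x | k ≤ -dyadicLevel (G x)}, G x ∂halfLine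
        ≤ C * ∫⁻ x in {x | F x ≠ 0} ∩ {x | k ≤ -dyadicLevel (F x) - 1}, F x ∂halfLine := by
    rw [hlevel_eq]
    by_cases hex : ∃ i, i ∈ D ∧ i ≤ -k
    · obtain ⟨i, ⟨hiD, hik⟩, hmax⟩ := Int.exists_greatest_of_bdd ⟨-k, fun j hj => hj.2⟩ hex
      calc _ ≤ ∫⁻ x in {x | G x < 2 ^ (i + 1)}, G x ∂halfLine := by
            refine setLIntegral_le_of_ne_zero (hA.inter (hκ measurableSet_Ici))
              (measurableSet_lt hG measurable_const)
              fun x hx h0 => ?_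
            have := hmax (dyadicLevel (G x)) ⟨hx.1 h0, le_neg.1 hx.2⟩
            exact (lt_two_zpow_iff h0 (hG_top x)).2 (Int.lt_add_one_of_le this)
        _ ≤ C * ∫⁻ x in {x | F x < 2 ^ i}, F x ∂halfLine := hle i hiD
        _ ≤ C * ∫⁻ x in {x | F x < 2 ^ (-k)}, F x ∂halfLine := by
            gcongr
            exact one_le_two
    · refine le_trans (setLIntegral_le_of_ne_zero (hA.inter (hκ measurableSet_Ici)) .empty
        fun x hx h0 => hex ⟨_, hx.1 h0, le_neg.1 hx.2⟩) ?_
      rw [Measure.restrict_empty, lintegral_zero_measure]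
      exact zero_le
  obtain ⟨φ, hφ, hφ_level⟩ := exists_isTransport_of_levels hA hB hC hG hκ hl hle_level
    fun k => (hlevel_eq k).trans_ne (hfin _)
  refine ⟨φ, hφ, ?_⟩
  filter_upwards [hφ_level] with x hx h0 hxD
  obtain ⟨hF0, hle⟩ := hx (fun _ => hxD) h0
  exact ⟨hF0, le_of_dyadicLevel_lt h0 (hG_top x) hF0 (hF_top _) (by omega)⟩

theorem exists_isTransport_of_measure_ge_le (hG : Measurable G) (hF : Measurable F)
    (hG_top : ∀ x, G x ≠ ∞) (hF_top : ∀ x, F x ≠ ∞) (hC : C ≠ ∞) (D : Set ℤ)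
    (hle : ∀ k ∈ D, halfLine {x | 2 ^ k ≤ G x} ≤ C * halfLine {x | 2 ^ k ≤ F x})
    (hfin : ∀ k : ℤ, halfLine {x | 2 ^ k ≤ F x} ≠ ∞) :
    ∃ φ, IsTransport 1 1 C {x | G x ≠ 0 ∧ dyadicLevel (G x) ∈ D} φ ∧
      ∀ᵐ x ∂halfLine, G x ≠ 0 → dyadicLevel (G x) ∈ D → G x ≤ 2 * F (φ x) := by
  have hκ : Measurable fun x => dyadicLevel (G x) := measurable_dyadicLevel.comp hG
  have hl : Measurable fun x => dyadicLevel (F x) := measurable_dyadicLevel.comp hF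
  have hA : MeasurableSet {x | G x ≠ 0 ∧ dyadicLevel (G x) ∈ D} :=
    (hG (measurableSet_singleton 0)).compl.inter (hκ (.of_discrete (s := D)))
  have hB : MeasurableSet {x | F x ≠ 0} := (hF (measurableSet_singleton 0)).compl
  have hset : ∀ k : ℤ, {x | F x ≠ 0} ∩ {x | k ≤ dyadicLevel (F x)} = {x | 2 ^ k ≤ F x} :=
    fun k => ext fun x => (two_zpow_le_iff (hF_top x)).symm
  have hle_level (k : ℤ) :
      halfLine ({x | G x ≠ 0 ∧ dyadicLevel (G x) ∈ D} ∩ {x | k ≤ dyadicLevel (G x)})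
        ≤ C * halfLine {x | 2 ^ k ≤ F x} := by
    by_cases hex : ∃ i, i ∈ D ∧ k ≤ i
    · obtain ⟨i, ⟨hiD, hki⟩, hmin⟩ := Int.exists_least_of_bdd ⟨k, fun j hj => hj.2⟩ hex
      calc _ ≤ halfLine {x | 2 ^ i ≤ G x} := measure_mono fun x hx =>
            (two_zpow_le_iff (hG_top x)).2 ⟨hx.1.1, hmin _ ⟨hx.1.2, hx.2⟩⟩
        _ ≤ C * halfLine {x | 2 ^ i ≤ F x} := hle i hiD
        _ ≤ C * halfLine {x | 2 ^ k ≤ F x} := by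
            gcongr
            exact one_le_two
    · refine (measure_mono (t := ∅) fun x hx => hex ⟨_, hx.1.2, hx.2⟩).trans ?_
      rw [measure_empty]
      exact zero_le
  obtain ⟨φ, hφ, hφ_level⟩ := exists_isTransport_of_levels (w := 1) (v := 1) hA hB hC
    measurable_one hκ hl
    (fun k => by simpa only [Pi.one_apply, setLIntegral_one, hset] using hle_level k)
    fun k => by simpa only [Pi.one_apply, setLIntegral_one, hset] using hfin k
  refine ⟨φ, hφ, ?_⟩
  filter_upwards [hφ_level] with x hx h0 hxD
  obtain ⟨hF0, hle⟩ := hx ⟨h0, hxD⟩ one_ne_zero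
  simpa only [zero_add, pow_one] using le_two_pow_mul_of_dyadicLevel_le (hG_top x) hF0 (hF_top _) 0
    (hle.trans_eq (add_zero _).symm)

/-- The integers `k` for which `F` is integrable above the height `2 ^ k`. -/
def integrableLevels (F : ℝ → ℝ≥0∞) : Set ℤ := {k | ∫⁻ x in {x | 2 ^ k ≤ F x}, F x ∂halfLine < ∞}

theorem isUpperSet_integrableLevels (F : ℝ → ℝ≥0∞) : IsUpperSet (integrableLevels F) :=
  fun _ j hij hi => lt_of_le_of_lt (lintegral_mono_set fun x (hx : 2 ^ j ≤ F x) =>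
    (ENNReal.zpow_le_of_le one_le_two hij).trans hx) hi

theorem integrableLevels_nonempty {t : ℝ≥0∞} (ht : t ≠ ∞)
    (h : ∫⁻ x in {x | t ≤ F x}, F x ∂halfLine < ∞) : (integrableLevels F).Nonempty := by
  obtain ⟨n, hn⟩ := ENNReal.exists_nat_gt ht
  refine ⟨n, lt_of_le_of_lt (lintegral_mono_set fun x (hx : 2 ^ (n : ℤ) ≤ F x) => ?_) h⟩
  calc t ≤ n := hn.le
    _ ≤ 2 ^ n := by exact_mod_cast Nat.lt_two_pow_self.le
    _ ≤ F x := by rwa [← zpow_natCast]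

theorem measure_two_zpow_le_eq_top (hF : Measurable F) {k : ℤ} (hk : k ∉ integrableLevels F)
    (hk' : k + 1 ∈ integrableLevels F) : halfLine {x | 2 ^ k ≤ F x} = ∞ := by
  by_contra htop
  have hset : MeasurableSet {x | 2 ^ (k + 1) ≤ F x} := measurableSet_le measurable_const hF
  refine hk (lt_of_le_of_lt ?_ (ENNReal.add_lt_top.2
    ⟨hk', ENNReal.mul_lt_top (two_zpow_ne_top (k + 1)).lt_top (lt_top_iff_ne_top.2 htop)⟩))
  calc ∫⁻ x in {x | 2 ^ k ≤ F x}, F x ∂halfLine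
      ≤ ∫⁻ x in {x | 2 ^ k ≤ F x},
          ({x | 2 ^ (k + 1) ≤ F x}.indicator F x + 2 ^ (k + 1)) ∂halfLine := by
        refine lintegral_mono fun x => ?_
        rcases le_or_gt (2 ^ (k + 1)) (F x) with hx | hx
        · rw [indicator_of_mem (show x ∈ {x | 2 ^ (k + 1) ≤ F x} from hx)]
          exact le_self_add
        · exact hx.le.trans le_add_self
    _ = (∫⁻ x in {x | 2 ^ k ≤ F x}, {x | 2 ^ (k + 1) ≤ F x}.indicator F x ∂halfLine)
          + 2 ^ (k + 1) * halfLine {x | 2 ^ k ≤ F x} := by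
        rw [lintegral_add_right _ measurable_const, setLIntegral_const]
    _ ≤ (∫⁻ x in {x | 2 ^ (k + 1) ≤ F x}, F x ∂halfLine)
          + 2 ^ (k + 1) * halfLine {x | 2 ^ k ≤ F x} := by
        rw [← lintegral_indicator hset]
        gcongr
        exact Measure.restrict_le_self

theorem exists_isTransport_of_not_mem_integrableLevels (hG_top : ∀ x, G x ≠ ∞) (hF : Measurable F)
    (hF_top : ∀ x, F x ≠ ∞) (hne : (integrableLevels F).Nonempty) :
    ∃ φ, IsTransport 1 1 1 {x | dyadicLevel (G x) - 1 ∈ integrableLevels F}ᶜ φ ∧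
      ∀ᵐ x ∂halfLine, dyadicLevel (G x) - 1 ∉ integrableLevels F → G x ≤ 4 * F (φ x) := by
  by_cases huniv : integrableLevels F = univ
  · refine ⟨id, ⟨measurable_id, ?_⟩, .of_forall fun x hx => absurd (huniv ▸ mem_univ _) hx⟩
    rw [Measure.map_id, withDensity_one, withDensity_one, one_smul]
    exact Measure.restrict_le_self
  obtain ⟨k, hk⟩ := (ne_univ_iff_exists_notMem _).1 huniv
  have hk_le : integrableLevels F ⊆ Ici k := fun j hj =>
    (le_total k j).resolve_right fun hjk => hk (isUpperSet_integrableLevels F hjk hj)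
  obtain ⟨i, hi, hIci⟩ := exists_inter_Ici_eq_Ici (isUpperSet_integrableLevels F) hne k
  rw [inter_eq_left.2 hk_le] at hIci
  have hpred : i - 1 ∉ integrableLevels F := by rw [hIci, mem_Ici]; omega
  obtain ⟨φ, hφ, hφ_mem⟩ := exists_isTransport_of_measure_eq_top
    (measurableSet_le measurable_const hF)
    (measure_two_zpow_le_eq_top hF hpred (by rwa [sub_add_cancel]))
    {x | dyadicLevel (G x) - 1 ∈ integrableLevels F}ᶜ
  refine ⟨φ, hφ, ?_⟩
  filter_upwards [hφ_mem] with x hx hGx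
  rw [hIci, mem_Ici, not_le] at hGx
  obtain ⟨hF0, hFx⟩ := (two_zpow_le_iff (hF_top _)).1 hx
  have := le_two_pow_mul_of_dyadicLevel_le (hG_top x) hF0 (hF_top _) 1 (by push_cast; omega)
  rwa [show (2 : ℝ≥0∞) ^ (1 + 1) = 4 by norm_num] at this

theorem HeadMajorized.exists_isTransport (h : HeadMajorized G F) (hG : Measurable G)
    (hF : Measurable F) (hG_top : ∀ x, G x ≠ ∞) (hF_top : ∀ x, F x ≠ ∞)
    (hfin : ∃ t ≠ ∞, ∫⁻ x in {x | t ≤ F x}, F x ∂halfLine < ∞) :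
    ∃ A, MeasurableSet A ∧
      (∃ φ, IsTransport G F 2 A φ ∧ ∀ᵐ x ∂halfLine, x ∈ A → G x ≤ 4 * F (φ x)) ∧
      ∃ φ, IsTransport 1 1 1 Aᶜ φ ∧ ∀ᵐ x ∂halfLine, x ∈ Aᶜ → G x ≤ 4 * F (φ x) := by
  obtain ⟨t, ht, hint⟩ := hfin
  have hne := integrableLevels_nonempty ht hint
  refine ⟨{x | dyadicLevel (G x) - 1 ∈ integrableLevels F},
    ((measurable_dyadicLevel.comp hG).sub_const 1) (.of_discrete (s := integrableLevels F)), ?_,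
    exists_isTransport_of_not_mem_integrableLevels hG_top hF hF_top hne⟩
  refine exists_isTransport_of_lintegral_ge_le hG hF hG_top hF_top ENNReal.ofNat_ne_top
    (isUpperSet_integrableLevels F) hne (fun k _ => ?_) fun k hk => ne_of_lt hk
  rw [two_zpow_add_one]
  exact h.lintegral_ge_le hG hF (two_zpow_ne_top k)

theorem TailMajorized.exists_isTransport (h : TailMajorized G F) (hG : Measurable G)
    (hF : Measurable F) (hG_top : ∀ x, G x ≠ ∞) (hF_top : ∀ x, F x ≠ ∞)
    (hfin : ∀ t ≠ ∞, ∫⁻ x, min (F x) t ∂halfLine < ∞) :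
    ∃ A, MeasurableSet A ∧
      (∃ φ, IsTransport G F 4 A φ ∧
        ∀ᵐ x ∂halfLine, x ∈ A → G x ≠ 0 → F (φ x) ≠ 0 ∧ F (φ x) ≤ G x) ∧
      ∃ φ, IsTransport 1 1 2 Aᶜ φ ∧ ∀ᵐ x ∂halfLine, x ∈ Aᶜ → G x ≤ 2 * F (φ x) := by
  set D : Set ℤ := {k | ∫⁻ x in {x | G x < 2 ^ (k + 1)}, G x ∂halfLine
    ≤ 4 * ∫⁻ x in {x | F x < 2 ^ k}, F x ∂halfLine}
  have hD : ∀ k ∈ Dᶜ, halfLine {x | 2 ^ k ≤ G x} ≤ 2 * halfLine {x | 2 ^ k ≤ F x} := fun k hk =>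
    (h.lintegral_lt_le_or hG hF (two_zpow_ne_zero k) (two_zpow_ne_top k)).resolve_left
      (by rwa [← two_zpow_add_one])
  have hfin_level : ∀ k : ℤ, (∫⁻ x in {x | F x < 2 ^ k}, F x ∂halfLine) < ∞ ∧
      2 ^ k * halfLine {x | 2 ^ k ≤ F x} < ∞ := fun k =>
    ENNReal.add_lt_top.1 (lintegral_min_eq hF (2 ^ k) ▸ hfin _ (two_zpow_ne_top k))
  obtain ⟨φ, hφ, hφ_le⟩ := exists_isTransport_of_lintegral_lt_le hG hF hG_top hF_top
    ENNReal.ofNat_ne_top D (fun _ hk => hk) fun k => (hfin_level k).1.ne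
  obtain ⟨ψ, hψ, hψ_le⟩ := exists_isTransport_of_measure_ge_le hG hF hG_top hF_top
    ENNReal.ofNat_ne_top Dᶜ hD fun k =>
      (ENNReal.lt_top_of_mul_ne_top_right (hfin_level k).2.ne (two_zpow_ne_zero k)).ne
  have hcompl : {x | G x ≠ 0 → dyadicLevel (G x) ∈ D}ᶜ = {x | G x ≠ 0 ∧ dyadicLevel (G x) ∈ Dᶜ} :=
    ext fun x => Classical.not_imp
  refine ⟨{x | G x ≠ 0 → dyadicLevel (G x) ∈ D}, measurableSet_ne_zero_imp_dyadicLevel_mem hG D,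
    ⟨φ, hφ, ?_⟩, ψ, hcompl ▸ hψ, ?_⟩
  · filter_upwards [hφ_le] with x hx hxA h0 using hx h0 (hxA h0)
  · filter_upwards [hψ_le] with x hx hxA
    rw [hcompl] at hxA
    exact hx hxA.1 hxA.2

end Transport

/-! ### Operators with prescribed values -/

namespace WeightedComp

variable {𝕜 : Type*} [RCLike 𝕜] {S : WeightedComp 𝕜}

theorem Bound.mono {r C C' : ℝ≥0∞} (h : S.Bound r C) (hC : C ≤ C') : S.Bound r C' := by
  rw [Bound] at h ⊢
  split_ifs at h ⊢
  · exact fun x => (h x).trans hC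
  · exact fun u hu => (h u hu).trans (by gcongr)

theorem density_le_mul_density {r r' M : ℝ≥0∞} (hr' : r' ≠ ∞) (hrr : r ≤ r')
    (hM : ∀ x, ‖S.weight x‖ₑ ≤ M) (x : ℝ) :
    S.density r' x ≤ M ^ (r'.toReal - r.toReal) * S.density r x := by
  have hsub : 0 ≤ r'.toReal - r.toReal := sub_nonneg.2 (ENNReal.toReal_mono hr' hrr)
  rw [density, density]
  split_ifs
  · exact zero_le
  · calc ‖S.weight x‖ₑ ^ r'.toReal
        = ‖S.weight x‖ₑ ^ (r'.toReal - r.toReal) * ‖S.weight x‖ₑ ^ r.toReal := by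
          rw [← ENNReal.rpow_add_of_nonneg _ _ hsub ENNReal.toReal_nonneg, sub_add_cancel]
      _ ≤ M ^ (r'.toReal - r.toReal) * ‖S.weight x‖ₑ ^ r.toReal := by
          gcongr
          exact hM x

theorem Bound.of_le_exponent {r r' C M : ℝ≥0∞} (h : S.Bound r C) (hr : r ≠ ∞) (hrr : r ≤ r')
    (hM : ∀ x, ‖S.weight x‖ₑ ≤ M) :
    S.Bound r' (max M (M ^ (r'.toReal - r.toReal) * C)) := by
  by_cases hr' : r' = ∞
  · rw [Bound, if_pos hr']
    exact fun x => (hM x).trans (le_max_left _ _)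
  refine Bound.mono ?_ (le_max_right _ _)
  rw [Bound, if_neg hr] at h
  rw [Bound, if_neg hr']
  intro u hu
  calc ∫⁻ x, S.density r' x * u (S.map x) ∂halfLine
      ≤ ∫⁻ x, M ^ (r'.toReal - r.toReal) * (S.density r x * u (S.map x)) ∂halfLine := by
        refine lintegral_mono fun x => ?_
        rw [← mul_assoc]
        gcongr
        exact density_le_mul_density hr' hrr hM x
    _ = M ^ (r'.toReal - r.toReal) * ∫⁻ x, S.density r x * u (S.map x) ∂halfLine :=
        lintegral_const_mul _ ((S.measurable_density r).mul (hu.comp S.measurable_map))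
    _ ≤ M ^ (r'.toReal - r.toReal) * C * ∫⁻ x, u x ∂halfLine := by
        rw [mul_assoc]
        gcongr
        exact h u hu

theorem Bound.of_ge_exponent {r r' C : ℝ≥0∞} (h : S.Bound r' C) (hr' : r' ≠ ∞) (hrr : r ≤ r')
    (hM : ∀ x, S.weight x ≠ 0 → 1 ≤ ‖S.weight x‖ₑ) : S.Bound r C := by
  rw [Bound, if_neg hr'] at h
  rw [Bound, if_neg (ne_top_of_le_ne_top hr' hrr)]
  refine fun u hu => le_trans (lintegral_mono fun x => ?_) (h u hu)
  gcongr
  rw [density, density]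
  split_ifs with h0
  · exact le_rfl
  · exact ENNReal.rpow_le_rpow_of_exponent_le (hM x h0) (ENNReal.toReal_mono hr' hrr)

section Ratio

variable {f g : MeasFun 𝕜} {A : Set ℝ} {φ : ℝ → ℝ} {hA : MeasurableSet A} {hφ : Measurable φ}

/-- The weighted composition operator with map `φ` and weight `g / (f ∘ φ)` on `A`, which sends `f`
to `g` on the points of `A` where `f ∘ φ` does not vanish. -/
noncomputable def ratio (f g : MeasFun 𝕜) (hA : MeasurableSet A) (hφ : Measurable φ) :
    WeightedComp 𝕜 where
  weight := A.indicator fun x => g x / f (φ x)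
  map := φ
  measurable_weight := (g.stronglyMeasurable.measurable.div
    (f.stronglyMeasurable.measurable.comp hφ)).indicator hA
  measurable_map := hφ

theorem ratio_weight (x : ℝ) :
    (ratio f g hA hφ).weight x = A.indicator (fun y => g y / f (φ y)) x :=
  rfl

theorem mem_and_ne_zero_of_ratio_weight_ne_zero {x : ℝ} (h : (ratio f g hA hφ).weight x ≠ 0) :
    x ∈ A ∧ f (φ x) ≠ 0 := by
  have hx : x ∈ A := by
    rw [ratio_weight] at h
    exact mem_of_indicator_ne_zero h
  refine ⟨hx, fun hf => h ?_⟩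
  rw [ratio_weight, indicator_of_mem hx, hf, div_zero]

theorem enorm_ratio_weight {x : ℝ} (h : (ratio f g hA hφ).weight x ≠ 0) :
    ‖(ratio f g hA hφ).weight x‖ₑ = ‖g x‖ₑ / ‖f (φ x)‖ₑ := by
  obtain ⟨hx, hf⟩ := mem_and_ne_zero_of_ratio_weight_ne_zero h
  rw [ratio_weight, indicator_of_mem hx, div_eq_mul_inv, enorm_mul, enorm_inv hf, div_eq_mul_inv]

theorem enorm_ratio_weight_le {M : ℝ≥0∞} (h : ∀ x ∈ A, ‖g x‖ₑ ≤ M * ‖f (φ x)‖ₑ) (x : ℝ) :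
    ‖(ratio f g hA hφ).weight x‖ₑ ≤ M := by
  by_cases h0 : (ratio f g hA hφ).weight x = 0
  · rw [h0, enorm_zero]
    exact zero_le
  · rw [enorm_ratio_weight h0]
    exact ENNReal.div_le_of_le_mul (h x (mem_and_ne_zero_of_ratio_weight_ne_zero h0).1)

theorem one_le_enorm_ratio_weight (h : ∀ x ∈ A, ‖f (φ x)‖ₑ ≤ ‖g x‖ₑ) {x : ℝ}
    (h0 : (ratio f g hA hφ).weight x ≠ 0) : 1 ≤ ‖(ratio f g hA hφ).weight x‖ₑ := by
  obtain ⟨hx, hf⟩ := mem_and_ne_zero_of_ratio_weight_ne_zero h0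
  rw [enorm_ratio_weight h0,
    ENNReal.le_div_iff_mul_le (.inl (enorm_ne_zero.2 hf)) (.inl enorm_ne_top), one_mul]
  exact h x hx

theorem ratio_density_le_indicator (r : ℝ≥0∞) (x : ℝ) : (ratio f g hA hφ).density r x ≤
    A.indicator (fun x => absPow g r.toReal x / absPow f r.toReal (φ x)) x := by
  by_cases h : (ratio f g hA hφ).weight x = 0
  · rw [density, if_pos h]
    exact zero_le
  · rw [density, if_neg h, enorm_ratio_weight h,
      indicator_of_mem (mem_and_ne_zero_of_ratio_weight_ne_zero h).1,
      ENNReal.div_rpow_of_nonneg _ _ ENNReal.toReal_nonneg, absPow, absPow]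

theorem ratio_bound {r C : ℝ≥0∞} (hr : r ≠ ∞)
    (h : IsTransport (absPow g r.toReal) (absPow f r.toReal) C A φ) :
    (ratio f g hA hφ).Bound r C := by
  rw [Bound, if_neg hr]
  intro u hu
  have hF : Measurable (absPow f r.toReal) := measurable_absPow f _
  have hG : Measurable (absPow g r.toReal) := measurable_absPow g _
  have hquot : Measurable fun y => u y / absPow f r.toReal y := hu.div hF
  calc ∫⁻ x, (ratio f g hA hφ).density r x * u (φ x) ∂halfLine
      ≤ ∫⁻ x, A.indicator
          (fun x => absPow g r.toReal x * (u (φ x) / absPow f r.toReal (φ x))) x ∂halfLine := by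
        refine lintegral_mono fun x =>
          (mul_le_mul_left (ratio_density_le_indicator r x) _).trans_eq ?_
        by_cases hx : x ∈ A
        · rw [indicator_of_mem hx, indicator_of_mem hx, ENNReal.mul_comm_div]
        · rw [indicator_of_notMem hx, indicator_of_notMem hx, zero_mul]
    _ = ∫⁻ x, u (φ x) / absPow f r.toReal (φ x)
          ∂((halfLine.restrict A).withDensity (absPow g r.toReal)) := by
        rw [lintegral_indicator hA]
        exact (lintegral_withDensity_eq_lintegral_mul _ hG (hquot.comp hφ)).symm
    _ = ∫⁻ y, u y / absPow f r.toReal y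
          ∂(((halfLine.restrict A).withDensity (absPow g r.toReal)).map φ) :=
        (lintegral_map hquot hφ).symm
    _ ≤ ∫⁻ y, u y / absPow f r.toReal y ∂(C • halfLine.withDensity (absPow f r.toReal)) :=
        lintegral_mono' h.map_le le_rfl
    _ = C * ∫⁻ y, absPow f r.toReal y * (u y / absPow f r.toReal y) ∂halfLine := by
        rw [lintegral_smul_measure, lintegral_withDensity_eq_lintegral_mul _ hF hquot]
        rfl
    _ ≤ C * ∫⁻ y, u y ∂halfLine := by
        gcongr
        exact ENNReal.mul_div_le

end Ratio

end WeightedComp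

/-! ### Monotonicity of interpolation spaces -/

section Monotonicity

variable {𝕜 : Type*} [RCLike 𝕜] {f g : MeasFun 𝕜} {A B : Set ℝ}

/-- The product of `g` with the indicator function of `A`. -/
noncomputable def MeasFun.indicator (g : MeasFun 𝕜) (hA : MeasurableSet A) : MeasFun 𝕜 :=
  AEEqFun.mk (A.indicator g) (g.stronglyMeasurable.indicator hA).aestronglyMeasurable

theorem MeasFun.coeFn_indicator (g : MeasFun 𝕜) (hA : MeasurableSet A) :
    g.indicator hA =ᵐ[halfLine] A.indicator g :=
  AEEqFun.coeFn_mk _ _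

theorem MeasFun.indicator_add_indicator_compl (g : MeasFun 𝕜) (hA : MeasurableSet A) :
    g.indicator hA + g.indicator hA.compl = g := by
  refine AEEqFun.ext ?_
  filter_upwards [AEEqFun.coeFn_add (g.indicator hA) (g.indicator hA.compl), g.coeFn_indicator hA,
    g.coeFn_indicator hA.compl] with x hadd hxA hxAc
  rw [hadd, Pi.add_apply, hxA, hxAc, indicator_self_add_compl_apply]

theorem WeightedComp.ratio_apply_eq_indicator (hA : MeasurableSet A) (hB : MeasurableSet B)
    (hBA : B ⊆ A) {φ : ℝ → ℝ} (hφ : Measurable φ)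
    (h : ∀ᵐ x ∂halfLine, x ∈ A → g x ≠ 0 → x ∈ B ∧ f (φ x) ≠ 0) :
    (ratio f g hB hφ).apply f = g.indicator hA := by
  refine AEEqFun.ext ?_
  filter_upwards [(ratio f g hB hφ).coeFn_apply f, h, g.coeFn_indicator hA] with x happly hx hind
  rw [happly, hind]
  change B.indicator (fun y => g y / f (φ y)) x * f (φ x) = _
  by_cases hxA : x ∈ A
  · rw [indicator_of_mem hxA]
    by_cases hg : g x = 0
    · have hzero : B.indicator (fun y => g y / f (φ y)) x = 0 :=
        indicator_apply_eq_zero.2 fun _ => by rw [hg, zero_div]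
      rw [hzero, zero_mul, hg]
    · rw [indicator_of_mem (hx hxA hg).1, div_mul_cancel₀ _ (hx hxA hg).2]
  · rw [indicator_of_notMem hxA, indicator_of_notMem fun hxB => hxA (hBA hxB), zero_mul]

theorem enorm_le_of_absPow_le {s : ℝ} (hs : 0 < s) {c : ℝ≥0∞} {x y : ℝ}
    (h : absPow g s x ≤ c * absPow f s y) : ‖g x‖ₑ ≤ c ^ s⁻¹ * ‖f y‖ₑ := by
  rw [← ENNReal.rpow_le_rpow_iff hs, ENNReal.mul_rpow_of_nonneg _ _ hs.le,
    ENNReal.rpow_inv_rpow hs.ne']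
  exact h

theorem absPow_toReal_zero (f : MeasFun 𝕜) : absPow f (0 : ℝ≥0∞).toReal = 1 :=
  funext fun x => by rw [absPow, ENNReal.toReal_zero, ENNReal.rpow_zero, Pi.one_apply]

theorem IsTransport.absPow_toReal_zero {C : ℝ≥0∞} {φ : ℝ → ℝ}
    (h : IsTransport 1 1 C A φ) (f g : MeasFun 𝕜) :
    IsTransport (absPow g (0 : ℝ≥0∞).toReal) (absPow f (0 : ℝ≥0∞).toReal) C A φ := by
  rwa [_root_.absPow_toReal_zero, _root_.absPow_toReal_zero]

namespace QuasiBanachFunctionSpace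

variable {E : QuasiBanachFunctionSpace 𝕜} {p q r C M : ℝ≥0∞}

theorem exists_bound_indicator_of_le (hpq : p < q)
    (hE : IsInterpolationSpace (LSpace 𝕜 p) (LSpace 𝕜 q) E.toSizedSpace) (hrp : r ≤ p)
    (hC : C ≠ ∞) (hM : M ≠ ∞) (hM0 : M ≠ 0) :
    ∃ K : ℝ, 0 < K ∧ ∀ f ∈ E.carrier, ∀ (g : MeasFun 𝕜) (A : Set ℝ) (hA : MeasurableSet A)
      (φ : ℝ → ℝ), IsTransport (absPow g r.toReal) (absPow f r.toReal) C A φ →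
      (∀ᵐ x ∂halfLine, x ∈ A → ‖g x‖ₑ ≤ M * ‖f (φ x)‖ₑ) →
      g.indicator hA ∈ E.carrier ∧ E.size (g.indicator hA) ≤ K * E.size f := by
  have hr : r ≠ ∞ := ne_top_of_le_ne_top hpq.ne_top hrp
  have hpow : ∀ s : ℝ, max M (M ^ s * C) < ∞ := fun s =>
    max_lt hM.lt_top (ENNReal.mul_lt_top (ENNReal.rpow_ne_top_of_ne_zero hM0 hM).lt_top hC.lt_top)
  obtain ⟨K, hK0, hK⟩ := exists_uniform_bound hpq.ne_top hE (max_lt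
    (hpow (p.toReal - r.toReal)) (hpow (q.toReal - r.toReal))).ne
  refine ⟨K, hK0, fun f hf g A hA φ hφ hle => ?_⟩
  have hB : MeasurableSet (A ∩ {x | ‖g x‖ₑ ≤ M * ‖f (φ x)‖ₑ}) :=
    hA.inter (measurableSet_le g.stronglyMeasurable.measurable.enorm
      ((f.stronglyMeasurable.measurable.comp hφ.measurable).enorm.const_mul _))
  have hbound := WeightedComp.ratio_bound (hA := hB) (hφ := hφ.measurable) hr
    (hφ.mono_set inter_subset_left)
  have hweight := WeightedComp.enorm_ratio_weight_le (hA := hB) (hφ := hφ.measurable)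
    fun x hx => hx.2
  have := hK _ ((hbound.of_le_exponent hr hrp hweight).mono (le_max_left _ _))
    ((hbound.of_le_exponent hr (hrp.trans hpq.le) hweight).mono (le_max_right _ _)) f hf
  rwa [WeightedComp.ratio_apply_eq_indicator hA hB inter_subset_left] at this
  filter_upwards [hle] with x hx hxA hg
  refine ⟨⟨hxA, hx hxA⟩, fun h0 => hg ?_⟩
  simpa only [h0, enorm_zero, mul_zero, nonpos_iff_eq_zero, enorm_eq_zero] using hx hxA

theorem exists_bound_indicator_of_ge (hpq : p < q) (hq : q ≠ ∞)
    (hE : IsInterpolationSpace (LSpace 𝕜 p) (LSpace 𝕜 q) E.toSizedSpace) (hC : C ≠ ∞) :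
    ∃ K : ℝ, 0 < K ∧ ∀ f ∈ E.carrier, ∀ (g : MeasFun 𝕜) (A : Set ℝ) (hA : MeasurableSet A)
      (φ : ℝ → ℝ), IsTransport (absPow g q.toReal) (absPow f q.toReal) C A φ →
      (∀ᵐ x ∂halfLine, x ∈ A → g x ≠ 0 → f (φ x) ≠ 0 ∧ ‖f (φ x)‖ₑ ≤ ‖g x‖ₑ) →
      g.indicator hA ∈ E.carrier ∧ E.size (g.indicator hA) ≤ K * E.size f := by
  obtain ⟨K, hK0, hK⟩ := exists_uniform_bound hpq.ne_top hE hC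
  refine ⟨K, hK0, fun f hf g A hA φ hφ hle => ?_⟩
  have hB : MeasurableSet (A ∩ {x | ‖f (φ x)‖ₑ ≤ ‖g x‖ₑ}) :=
    hA.inter (measurableSet_le (f.stronglyMeasurable.measurable.comp hφ.measurable).enorm
      g.stronglyMeasurable.measurable.enorm)
  have hbound := WeightedComp.ratio_bound (hA := hB) (hφ := hφ.measurable) hq
    (hφ.mono_set inter_subset_left)
  have hweight := fun x => WeightedComp.one_le_enorm_ratio_weight (hA := hB) (hφ := hφ.measurable)
    (fun y hy => hy.2) (x := x)
  have := hK _ (hbound.of_ge_exponent hq hpq.le hweight) hbound f hf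
  rwa [WeightedComp.ratio_apply_eq_indicator hA hB inter_subset_left] at this
  filter_upwards [hle] with x hx hxA hg
  exact ⟨⟨hxA, (hx hxA hg).2⟩, (hx hxA hg).1⟩

theorem mem_and_size_le_of_indicator {K K₁ K₂ : ℝ} (hK : 0 ≤ K)
    (htri : ∀ f ∈ E.carrier, ∀ g ∈ E.carrier, E.size (f + g) ≤ K * (E.size f + E.size g))
    (hA : MeasurableSet A)
    (h₁ : g.indicator hA ∈ E.carrier ∧ E.size (g.indicator hA) ≤ K₁ * E.size f)
    (h₂ : g.indicator hA.compl ∈ E.carrier ∧ E.size (g.indicator hA.compl) ≤ K₂ * E.size f) :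
    g ∈ E.carrier ∧ E.size g ≤ K * (K₁ + K₂) * E.size f := by
  have hsum := g.indicator_add_indicator_compl hA
  refine ⟨hsum ▸ E.carrier.add_mem h₁.1 h₂.1, ?_⟩
  calc E.size g = E.size (g.indicator hA + g.indicator hA.compl) := by rw [hsum]
    _ ≤ K * (E.size (g.indicator hA) + E.size (g.indicator hA.compl)) := htri _ h₁.1 _ h₂.1
    _ ≤ K * (K₁ * E.size f + K₂ * E.size f) := by gcongr; exacts [h₁.2, h₂.2]
    _ = K * (K₁ + K₂) * E.size f := by ring

theorem exists_bound_of_headMajorized (hpq : p < q) (hp : p ≠ 0)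
    (hE : IsInterpolationSpace (LSpace 𝕜 p) (LSpace 𝕜 q) E.toSizedSpace) :
    ∃ c : ℝ, 0 < c ∧ ∀ f ∈ E.carrier, ∀ g : MeasFun 𝕜,
      HeadMajorized (absPow g p.toReal) (absPow f p.toReal) →
        g ∈ E.carrier ∧ E.size g ≤ c * E.size f := by
  have hp0 : 0 < p.toReal := ENNReal.toReal_pos hp hpq.ne_top
  have hM0 : (4 : ℝ≥0∞) ^ p.toReal⁻¹ ≠ 0 :=
    (ENNReal.rpow_pos four_pos ENNReal.ofNat_ne_top).ne'
  have hM : (4 : ℝ≥0∞) ^ p.toReal⁻¹ ≠ ∞ :=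
    ENNReal.rpow_ne_top_of_nonneg (inv_nonneg.2 hp0.le) ENNReal.ofNat_ne_top
  obtain ⟨K, hK, htri⟩ := E.exists_quasi_triangle
  obtain ⟨K₁, hK₁, h₁⟩ :=
    exists_bound_indicator_of_le hpq hE le_rfl (ENNReal.ofNat_ne_top (n := 2)) hM hM0
  obtain ⟨K₂, hK₂, h₂⟩ := exists_bound_indicator_of_le hpq hE zero_le ENNReal.one_ne_top hM hM0
  refine ⟨K * (K₁ + K₂), by positivity, fun f hf g hmaj => ?_⟩
  obtain ⟨A, hA, ⟨φ, hφ, hφ_le⟩, ψ, hψ, hψ_le⟩ := hmaj.exists_isTransport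
    (measurable_absPow g _) (measurable_absPow f _) (absPow_ne_top g hp0.le)
    (absPow_ne_top f hp0.le) (exists_lintegral_absPow_ge_lt_top hpq hp (hE.2.1 hf))
  refine mem_and_size_le_of_indicator (by linarith) htri hA (h₁ f hf g A hA φ hφ ?_)
    (h₂ f hf g _ hA.compl ψ (hψ.absPow_toReal_zero f g) ?_)
  · filter_upwards [hφ_le] with x hx hxA using enorm_le_of_absPow_le hp0 (hx hxA)
  · filter_upwards [hψ_le] with x hx hxA using enorm_le_of_absPow_le hp0 (hx hxA)

theorem exists_bound_of_tailMajorized (hpq : p < q) (hq : q ≠ ∞)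
    (hE : IsInterpolationSpace (LSpace 𝕜 p) (LSpace 𝕜 q) E.toSizedSpace) :
    ∃ c : ℝ, 0 < c ∧ ∀ f ∈ E.carrier, ∀ g : MeasFun 𝕜,
      TailMajorized (absPow g q.toReal) (absPow f q.toReal) →
        g ∈ E.carrier ∧ E.size g ≤ c * E.size f := by
  have hq0 : 0 < q.toReal := ENNReal.toReal_pos hpq.ne_bot hq
  have hM0 : (2 : ℝ≥0∞) ^ q.toReal⁻¹ ≠ 0 :=
    (ENNReal.rpow_pos two_pos ENNReal.ofNat_ne_top).ne'
  have hM : (2 : ℝ≥0∞) ^ q.toReal⁻¹ ≠ ∞ :=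
    ENNReal.rpow_ne_top_of_nonneg (inv_nonneg.2 hq0.le) ENNReal.ofNat_ne_top
  obtain ⟨K, hK, htri⟩ := E.exists_quasi_triangle
  obtain ⟨K₁, hK₁, h₁⟩ := exists_bound_indicator_of_ge hpq hq hE (ENNReal.ofNat_ne_top (n := 4))
  obtain ⟨K₂, hK₂, h₂⟩ :=
    exists_bound_indicator_of_le hpq hE zero_le (ENNReal.ofNat_ne_top (n := 2)) hM hM0
  refine ⟨K * (K₁ + K₂), by positivity, fun f hf g hmaj => ?_⟩
  obtain ⟨A, hA, ⟨φ, hφ, hφ_le⟩, ψ, hψ, hψ_le⟩ := hmaj.exists_isTransport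
    (measurable_absPow g _) (measurable_absPow f _) (absPow_ne_top g hq0.le)
    (absPow_ne_top f hq0.le) fun t ht => lintegral_min_absPow_lt_top hpq hq (hE.2.1 hf) ht
  have absPow_ne_zero_iff (u : MeasFun 𝕜) (x : ℝ) : absPow u q.toReal x ≠ 0 ↔ u x ≠ 0 := by
    rw [absPow, Ne, ENNReal.rpow_eq_zero_iff_of_pos hq0, enorm_eq_zero]
  refine mem_and_size_le_of_indicator (by linarith) htri hA (h₁ f hf g A hA φ hφ ?_)
    (h₂ f hf g _ hA.compl ψ (hψ.absPow_toReal_zero f g) ?_)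
  · filter_upwards [hφ_le] with x hx hxA hg
    obtain ⟨hf0, hle⟩ := hx hxA ((absPow_ne_zero_iff g x).2 hg)
    exact ⟨(absPow_ne_zero_iff f _).1 hf0, (ENNReal.rpow_le_rpow_iff hq0).1 hle⟩
  · filter_upwards [hψ_le] with x hx hxA using enorm_le_of_absPow_le hq0 (hx hxA)

end QuasiBanachFunctionSpace

end Monotonicity

theorem mainTheorem4 {𝕜 : Type*} [RCLike 𝕜] (p q : ℝ≥0∞) (hpq : p < q)
    (E : QuasiBanachFunctionSpace 𝕜)
    (hE : IsInterpolationSpace (LSpace 𝕜 p) (LSpace 𝕜 q) E.toSizedSpace) :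
    ∃ cp cq : ℝ, 0 < cp ∧ 0 < cq ∧
      (p ≠ 0 → ∀ f ∈ E.carrier, ∀ g ∈ (LSpace 𝕜 p).carrier ⊔ (LSpace 𝕜 ∞).carrier,
        HeadMajorized (absPow g p.toReal) (absPow f p.toReal) →
          g ∈ E.carrier ∧ E.size g ≤ cp * E.size f) ∧
      (q ≠ ∞ → ∀ f ∈ E.carrier, ∀ g ∈ (LSpace 𝕜 0).carrier ⊔ (LSpace 𝕜 q).carrier,
        TailMajorized (absPow g q.toReal) (absPow f q.toReal) →
          g ∈ E.carrier ∧ E.size g ≤ cq * E.size f) := by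
  have hhead : ∃ c : ℝ, 0 < c ∧ (p ≠ 0 → ∀ f ∈ E.carrier, ∀ g : MeasFun 𝕜,
      HeadMajorized (absPow g p.toReal) (absPow f p.toReal) →
        g ∈ E.carrier ∧ E.size g ≤ c * E.size f) := by
    by_cases hp : p = 0
    · exact ⟨1, one_pos, fun h => absurd hp h⟩
    · obtain ⟨c, hc, h⟩ := QuasiBanachFunctionSpace.exists_bound_of_headMajorized hpq hp hE
      exact ⟨c, hc, fun _ => h⟩
  have htail : ∃ c : ℝ, 0 < c ∧ (q ≠ ∞ → ∀ f ∈ E.carrier, ∀ g : MeasFun 𝕜,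
      TailMajorized (absPow g q.toReal) (absPow f q.toReal) →
        g ∈ E.carrier ∧ E.size g ≤ c * E.size f) := by
    by_cases hq : q = ∞
    · exact ⟨1, one_pos, fun h => absurd hq h⟩
    · obtain ⟨c, hc, h⟩ := QuasiBanachFunctionSpace.exists_bound_of_tailMajorized hpq hq hE
      exact ⟨c, hc, fun _ => h⟩
  obtain ⟨cp, hcp, hp⟩ := hhead
  obtain ⟨cq, hcq, hq⟩ := htail
  exact ⟨cp, cq, hcp, hcq, fun h0 f hf g _ => hp h0 f hf g, fun h0 f hf g _ => hq h0 f hf g⟩
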